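/- Let $d\ge 1$. For $f\in L^2(\mathbb R^d)$ and $\psi\in L^1(\mathbb R^d)\cap L^2(\mathbb R^d)$ (complex-valued, modulo equality a.e.) put $U[\psi]f:=|f*\psi|$; for a path $p=(\psi_1,\dots,\psi_N)$ put $U[p]f:=U[\psi_N]\cdots U[\psi_1]f$, and for a set $\Phi$ of such functions put $W_N[\Phi](f):=\sum_{p\in\Phi^N}\|U[p]f\|_2^2$. For $A\in\mathrm{GL}_d(\mathbb R)$ put $D_A^1f:=|\det A|\,f(A\,\cdot)$ and $D_A^2f:=|\det A|^{1/2}f(A\,\cdot)$. A countable family $(\varphi_i)_{i}$ in $L^1(\mathbb R^d)\cap L^2(\mathbb R^d)$ is called a semi-discrete Parseval frame if $\sum_i\|f*\varphi_i\|_2^2=\|f\|_2^2$ for all $f\in L^2(\mathbb R^d)$. Let $\chi\in L^1(\mathbb R^d)\cap L^2(\mathbb R^d)$ and let $\Psi\subset L^1(\mathbb R^d)\cap L^2(\mathbb R^d)$ be countably infinite, such that $\chi$ together with $\Psi$ forms a semi-discrete Parseval frame, i.e. $\|f*\chi\|_2^2+\sum_{\psi\in\Psi}\|f*\psi\|_2^2=\|f\|_2^2$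 for all $f\in L^2(\mathbb R^d)$. Let $A\in\mathrm{GL}_d(\mathbb R)$ have smallest singular value $\sigma_{\min}(A)>1$, put $\Psi_m:=D^1_{A^{-m}}\Psi=\{D^1_{A^{-m}}\psi:\psi\in\Psi\}$, and assume $\Psi_m\subseteq\Psi_{m+1}$ for all $m\ge 1$. Then: 1. $\Psi_\infty:=\bigcup_{m\ge1}\Psi_m$ is a semi-discrete Parseval frame. 2. For all $f\in L^2(\mathbb R^d)$ and all integers $k\ge1$, $\lim_{m\to\infty}W_k[\Psi](D^2_{A^m}f)=\|f\|_2^2$. 3. $\displaystyle\delta:=\inf_{f\in L^2(\mathbb R^d),\,\|f\|_2=1}\ \inf_{k\ge1}\ \limsup_{m\to\infty}W_k[\Psi](D^2_{A^m}f)=1$. 4. For every $g\in L^2(\mathbb R^d)$ there is a constant $C_g>0$ such that for every nonincreasing sequence $E=(E_N)_{N\ge1}$ of positive reals with $E_N\to0$ there is $f_{g,E}\in L^2(\mathbb R^d)$ with $$\|f_{g,E}\|_2^2\le C_g(1+E_1),\qquad \|f_{g,E}-g\|_2^2\le C_gE_1,\qquad W_N[\Psi](f_{g,E})\ge\tfrac{\|g\|_2^2}{8}\,E_N\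 \text{ for all }N\ge1.$$ 5. For every nonincreasing sequence $E=(E_N)_{N\ge1}$ of positive reals with $E_N\to0$, the set $$Y_E:=\{f\in L^2(\mathbb R^d): \exists\, C>0,\ N_0\ge1\ \ \forall N\ge N_0:\ W_N[\Psi](f)\le C\,E_N\}$$ is a countable union of nowhere dense sets in $L^2(\mathbb R^d)$; in particular $L^2(\mathbb R^d)\setminus Y_E$ is dense in $L^2(\mathbb R^d)$. -/

import Mathlib

open MeasureTheory
open scoped ENNReal Topology

noncomputable section

namespace Scattering

/-- The Hilbert space `L²(ℝᵈ)` of complex-valued functions (modulo equality a.e.). -/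
abbrev L2 (d : ℕ) : Type :=
  Lp ℂ 2 (volume : Measure (EuclideanSpace ℝ (Fin d)))

/-- The set `L¹(ℝᵈ) ∩ L²(ℝᵈ)` of filters, as those classes in `L²(ℝᵈ)` that are integrable. -/
abbrev FilterFn (d : ℕ) : Type :=
  {ψ : L2 d // MemLp ψ 1 (volume : Measure (EuclideanSpace ℝ (Fin d)))}

/-- The pointwise convolution `x ↦ ∫ f(t) ψ(x - t) dt`. -/
def convFun {d : ℕ} (f ψ : EuclideanSpace ℝ (Fin d) → ℂ) : EuclideanSpace ℝ (Fin d) → ℂ :=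
  convolution f ψ (ContinuousLinearMap.mul ℝ ℂ) volume

/-- Cauchy-Schwarz for the measure with density `b`. -/
theorem lintegral_mul_sq_le {α : Type*} [MeasurableSpace α] {μ : Measure α} {a b : α → ℝ≥0∞}
    (ha : AEMeasurable a μ) (hb : AEMeasurable b μ) :
    (∫⁻ t, a t * b t ∂μ) ^ 2 ≤ (∫⁻ t, a t ^ 2 * b t ∂μ) * ∫⁻ t, b t ∂μ := by
  have hsq : ∀ x : ℝ≥0∞, (x ^ (1 / 2 : ℝ)) ^ 2 = x := fun x => by
    rw [← ENNReal.rpow_natCast, ← ENNReal.rpow_mul]; norm_num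
  have hsq' : ∀ x : ℝ≥0∞, (x ^ (1 / 2 : ℝ)) * (x ^ (1 / 2 : ℝ)) = x := fun x => by
    rw [← pow_two, hsq]
  have h := ENNReal.lintegral_mul_le_Lp_mul_Lq μ Real.HolderConjugate.two_two
    (f := fun t => a t * b t ^ (1 / 2 : ℝ)) (g := fun t => b t ^ (1 / 2 : ℝ))
    (ha.mul (hb.pow_const _)) (hb.pow_const _)
  have h2 := pow_le_pow_left' h 2
  have e1 : ∀ t, a t * b t ^ (1 / 2 : ℝ) * b t ^ (1 / 2 : ℝ) = a t * b t := fun t => by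
    rw [mul_assoc, hsq']
  have e2 : ∀ t, (a t * b t ^ (1 / 2 : ℝ)) ^ (2 : ℝ) = a t ^ 2 * b t := fun t => by
    rw [ENNReal.rpow_two, mul_pow, hsq]
  have e3 : ∀ t, (b t ^ (1 / 2 : ℝ)) ^ (2 : ℝ) = b t := fun t => by
    rw [ENNReal.rpow_two, hsq]
  simpa only [Pi.mul_apply, e1, e2, e3, mul_pow, hsq] using h2

/-- Young's inequality `L² * L¹ ⊆ L²`. -/
theorem memLp_convFun {d : ℕ} {f ψ : EuclideanSpace ℝ (Fin d) → ℂ}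
    (hf : MemLp f 2 volume) (hψ : MemLp ψ 1 volume) : MemLp (convFun f ψ) 2 volume := by
  have hmeas : AEStronglyMeasurable
      (fun p : EuclideanSpace ℝ (Fin d) × EuclideanSpace ℝ (Fin d) => f p.2 * ψ (p.1 - p.2))
      (volume.prod volume) := by
    simpa using AEStronglyMeasurable.convolution_integrand (ContinuousLinearMap.mul ℝ ℂ)
      (μ := (volume : Measure (EuclideanSpace ℝ (Fin d))))
      (ν := (volume : Measure (EuclideanSpace ℝ (Fin d))))
      hf.aestronglyMeasurable hψ.aestronglyMeasurable
  have hcm : AEStronglyMeasurable (convFun f ψ) volume := by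
    have := hmeas.integral_prod_right'
    have he : convFun f ψ = fun x => ∫ t, f t * ψ (x - t) := by
      funext x
      simp [convFun, convolution_def]
    rw [he]
    exact this
  refine ⟨hcm, ?_⟩
  rw [eLpNorm_lt_top_iff_lintegral_rpow_enorm_lt_top (by norm_num) (by norm_num)]
  simp only [ENNReal.toReal_ofNat, ENNReal.rpow_two]
  have hf2 : (∫⁻ t, ‖f t‖ₑ ^ 2) < ∞ := by
    have := (eLpNorm_lt_top_iff_lintegral_rpow_enorm_lt_top (f := f)
      (μ := (volume : Measure (EuclideanSpace ℝ (Fin d)))) (p := 2) (by norm_num)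
      (by norm_num)).1 hf.2
    simpa only [ENNReal.toReal_ofNat, ENNReal.rpow_two] using this
  have hψ1 : (∫⁻ t, ‖ψ t‖ₑ) < ∞ := by
    have := hψ.2
    rwa [eLpNorm_one_eq_lintegral_enorm] at this
  have hshift : ∀ x : EuclideanSpace ℝ (Fin d), (∫⁻ t, ‖ψ (x - t)‖ₑ) = ∫⁻ t, ‖ψ t‖ₑ := fun x =>
    lintegral_sub_left_eq_self (fun t => ‖ψ t‖ₑ) x
  have hshift' : ∀ t : EuclideanSpace ℝ (Fin d), (∫⁻ x, ‖ψ (x - t)‖ₑ) = ∫⁻ x, ‖ψ x‖ₑ := fun t =>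
    lintegral_sub_right_eq_self (fun x => ‖ψ x‖ₑ) t
  have hψx : ∀ x : EuclideanSpace ℝ (Fin d),
      AEStronglyMeasurable (fun t => ψ (x - t)) volume := fun x =>
    hψ.aestronglyMeasurable.comp_quasiMeasurePreserving
      (quasiMeasurePreserving_sub_left volume x)
  have hpt : ∀ x, ‖convFun f ψ x‖ₑ ^ 2 ≤
      (∫⁻ t, ‖f t‖ₑ ^ 2 * ‖ψ (x - t)‖ₑ) * ∫⁻ t, ‖ψ t‖ₑ := by
    intro x
    have h1 : ‖convFun f ψ x‖ₑ ≤ ∫⁻ t, ‖f t‖ₑ * ‖ψ (x - t)‖ₑ := by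
      refine (enorm_integral_le_lintegral_enorm _).trans (le_of_eq ?_)
      simp
    refine (pow_le_pow_left' h1 2).trans ?_
    rw [← hshift x]
    exact lintegral_mul_sq_le hf.aestronglyMeasurable.enorm (hψx x).enorm
  have hm2 : AEMeasurable
      (fun p : EuclideanSpace ℝ (Fin d) × EuclideanSpace ℝ (Fin d) =>
        ‖f p.2‖ₑ ^ 2 * ‖ψ (p.1 - p.2)‖ₑ) (volume.prod volume) := by
    have h1 : AEMeasurable (fun p : EuclideanSpace ℝ (Fin d) × EuclideanSpace ℝ (Fin d) =>
        ‖f p.2‖ₑ ^ 2) (volume.prod volume) :=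
      (hf.aestronglyMeasurable.comp_snd.enorm).pow_const 2
    have h2 : AEMeasurable (fun p : EuclideanSpace ℝ (Fin d) × EuclideanSpace ℝ (Fin d) =>
        ‖ψ (p.1 - p.2)‖ₑ) (volume.prod volume) :=
      (hψ.aestronglyMeasurable.comp_quasiMeasurePreserving
        (quasiMeasurePreserving_sub_of_right_invariant volume volume)).enorm
    exact h1.mul h2
  calc (∫⁻ x, ‖convFun f ψ x‖ₑ ^ 2)
      ≤ ∫⁻ x, (∫⁻ t, ‖f t‖ₑ ^ 2 * ‖ψ (x - t)‖ₑ) * ∫⁻ t, ‖ψ t‖ₑ := lintegral_mono hpt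
    _ = (∫⁻ x, ∫⁻ t, ‖f t‖ₑ ^ 2 * ‖ψ (x - t)‖ₑ) * ∫⁻ t, ‖ψ t‖ₑ :=
        lintegral_mul_const' _ _ hψ1.ne
    _ = (∫⁻ t, ∫⁻ x, ‖f t‖ₑ ^ 2 * ‖ψ (x - t)‖ₑ) * ∫⁻ t, ‖ψ t‖ₑ := by
        rw [lintegral_lintegral_swap hm2]
    _ = ((∫⁻ t, ‖f t‖ₑ ^ 2) * ∫⁻ x, ‖ψ x‖ₑ) * ∫⁻ t, ‖ψ t‖ₑ := by
        congr 1
        rw [← lintegral_mul_const' _ _ hψ1.ne]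
        refine lintegral_congr fun t => ?_
        rw [lintegral_const_mul' _ _ (by simp), hshift']
    _ < ∞ := ENNReal.mul_lt_top (ENNReal.mul_lt_top hf2 hψ1) hψ1

/-- The convolution `f * ψ ∈ L²(ℝᵈ)` of `f ∈ L²(ℝᵈ)` and `ψ ∈ L¹(ℝᵈ) ∩ L²(ℝᵈ)`. -/
def conv {d : ℕ} (f : L2 d) (ψ : FilterFn d) : L2 d :=
  (memLp_convFun (Lp.memLp f) ψ.2).toLp (convFun f ψ.1)

/-- The single step scattering propagator `U[ψ] f = |f * ψ|`. -/
def propagator {d : ℕ} (ψ : FilterFn d) (f : L2 d) : L2 d :=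
  (Lp.memLp (conv f ψ)).norm.ofReal.toLp (fun x => ((‖conv f ψ x‖ : ℝ) : ℂ))

/-- The scattering propagator `U[p] f = U[ψ_N] ⋯ U[ψ_1] f` along `p = (ψ_1, …, ψ_N)`. -/
def pathPropagator {d : ℕ} : (N : ℕ) → (Fin N → FilterFn d) → L2 d → L2 d
  | 0, _, f => f
  | N + 1, p, f => pathPropagator N (Fin.tail p) (propagator (p 0) f)

/-- `W_N[Φ](f) = ∑_{p ∈ Φ^N} ‖U[p] f‖²`, with values in `[0, ∞]`. -/
def energyRemainder {d : ℕ} (Φ : Set (FilterFn d)) (N : ℕ) (f : L2 d) : ℝ≥0∞ :=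
  ∑' p : Fin N → Φ, ‖pathPropagator N (fun i => (p i : FilterFn d)) f‖ₑ ^ 2

/-- A countable family of filters is a semi-discrete Parseval frame if
`∑_i ‖f * φ_i‖² = ‖f‖²` for all `f ∈ L²(ℝᵈ)`. -/
def IsSemiDiscreteParsevalFrame {d : ℕ} {ι : Type} (φ : ι → FilterFn d) : Prop :=
  Countable ι ∧ ∀ f : L2 d, HasSum (fun i => ‖conv f (φ i)‖ ^ 2) (‖f‖ ^ 2)

/-- The standing assumption on an output-generating filter `χ` and a set of filters `Ψ`: they form
a countably infinite collection with `‖f * χ‖² + ∑_{ψ ∈ Ψ} ‖f * ψ‖² = ‖f‖²` for all `f`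
(here `none` indexes `χ`). -/
structure IsFilterBank {d : ℕ} (χ : FilterFn d) (Ψ : Set (FilterFn d)) : Prop where
  infinite : Ψ.Infinite
  parseval : IsSemiDiscreteParsevalFrame
    (fun o : Option Ψ => o.elim χ (fun ψ => (ψ : FilterFn d)))

/-- The smallest singular value of a `d × d` matrix (`d ≥ 1`). Mathlib lists the singular values
in decreasing order, starting with index `0`. -/
def sigmaMin {d : ℕ} (A : Matrix (Fin d) (Fin d) ℝ) : ℝ :=
  (Matrix.toEuclideanLin A).singularValues (d - 1)

/-- `x ↦ A x` on `ℝᵈ`. -/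
abbrev act {d : ℕ} (A : GL (Fin d) ℝ) (x : EuclideanSpace ℝ (Fin d)) :
    EuclideanSpace ℝ (Fin d) :=
  Matrix.toEuclideanLin (A : Matrix (Fin d) (Fin d) ℝ) x

theorem memLp_comp_act {d : ℕ} (A : GL (Fin d) ℝ) {p : ℝ≥0∞} {f : EuclideanSpace ℝ (Fin d) → ℂ}
    (hf : MemLp f p volume) : MemLp (fun x => f (act A x)) p volume := by
  have hdet : LinearMap.det (Matrix.toEuclideanLin (A : Matrix (Fin d) (Fin d) ℝ)) ≠ 0 := by
    rw [show Matrix.toEuclideanLin (A : Matrix (Fin d) (Fin d) ℝ) = Matrix.toLin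
      (PiLp.basisFun 2 ℝ (Fin d)) (PiLp.basisFun 2 ℝ (Fin d)) A from by
        rw [← Matrix.toLpLin_eq_toLin], LinearMap.det_toLin]
    exact A.isUnit.map Matrix.detMonoidHom |>.ne_zero
  have hm : Measurable (act A) := by
    have : Continuous (Matrix.toEuclideanLin (A : Matrix (Fin d) (Fin d) ℝ)) :=
      LinearMap.continuous_of_finiteDimensional _
    exact this.measurable
  have hmap := Measure.map_linearMap_addHaar_eq_smul_addHaar
    (volume : Measure (EuclideanSpace ℝ (Fin d))) hdet
  refine MemLp.comp_of_map (g := f) (f := act A) ?_ hm.aemeasurable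
  change MemLp f p (Measure.map (Matrix.toEuclideanLin (A : Matrix (Fin d) (Fin d) ℝ)) volume)
  rw [hmap]
  exact hf.smul_measure ENNReal.ofReal_ne_top

/-- The dilation `D_A^2 f = |det A|^{1/2} f(A ·)` on `L²(ℝᵈ)`. -/
def dilation2 {d : ℕ} (A : GL (Fin d) ℝ) (f : L2 d) : L2 d :=
  ((memLp_comp_act A (Lp.memLp f)).const_mul
    ((√|(A : Matrix (Fin d) (Fin d) ℝ).det| : ℝ) : ℂ)).toLp
    (fun x => ((√|(A : Matrix (Fin d) (Fin d) ℝ).det| : ℝ) : ℂ) * f (act A x))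

/-- The dilation `D_A^1 ψ = |det A| ψ(A ·)` on `L¹(ℝᵈ) ∩ L²(ℝᵈ)`. -/
def dilation1 {d : ℕ} (A : GL (Fin d) ℝ) (ψ : FilterFn d) : FilterFn d :=
  ⟨((memLp_comp_act A (Lp.memLp ψ.1)).const_mul
      ((|(A : Matrix (Fin d) (Fin d) ℝ).det| : ℝ) : ℂ)).toLp
      (fun x => ((|(A : Matrix (Fin d) (Fin d) ℝ).det| : ℝ) : ℂ) * ψ.1 (act A x)),
    (memLp_congr_ae (MemLp.coeFn_toLp _)).2
      ((memLp_comp_act A ψ.2).const_mul ((|(A : Matrix (Fin d) (Fin d) ℝ).det| : ℝ) : ℂ))⟩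

/-- `Ψ_m = D_{A^{-m}}^1 Ψ`. -/
def dilatedFilters {d : ℕ} (A : GL (Fin d) ℝ) (Ψ : Set (FilterFn d)) (m : ℕ) :
    Set (FilterFn d) :=
  dilation1 ((A ^ m)⁻¹) '' Ψ

/-- `Ψ_∞ = ⋃_{m ≥ 1} Ψ_m`. -/
def unionDilatedFilters {d : ℕ} (A : GL (Fin d) ℝ) (Ψ : Set (FilterFn d)) : Set (FilterFn d) :=
  ⋃ m ∈ Set.Ici (1 : ℕ), dilatedFilters A Ψ m

/-- Nonincreasing null-sequences `(E_N)_{N ≥ 1}` of positive reals (the value `E 0` is unused). -/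
structure IsNullSequence (E : ℕ → ℝ) : Prop where
  pos : ∀ N, 1 ≤ N → 0 < E N
  antitone : AntitoneOn E (Set.Ici 1)
  tendsto : Filter.Tendsto E Filter.atTop (𝓝 0)

/-- `Y_E = {f | W_N[Ψ](f) ∈ O(E_N)}`. -/
def fastDecay {d : ℕ} (Ψ : Set (FilterFn d)) (E : ℕ → ℝ) : Set (L2 d) :=
  {f | ∃ C : ℝ, 0 < C ∧ ∃ N₀ : ℕ, 1 ≤ N₀ ∧
    ∀ N, N₀ ≤ N → energyRemainder Ψ N f ≤ ENNReal.ofReal (C * E N)}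

/-- `δ = inf_{‖f‖ = 1} inf_{k ≥ 1} limsup_{m → ∞} W_k[Ψ](D_{A_m}^2 f)` for a sequence `A_m`. -/
def deltaConst {d : ℕ} (Ψ : Set (FilterFn d)) (A : ℕ → GL (Fin d) ℝ) : ℝ≥0∞ :=
  ⨅ (f : L2 d) (_ : ‖f‖ = 1) (k : ℕ) (_ : 1 ≤ k),
    Filter.limsup (fun m => energyRemainder Ψ k (dilation2 (A m) f)) Filter.atTop

end Scattering

end

namespace Scattering

/-! Dilation intertwines with the propagator, so `W_k[Ψ](D²_{A^m} f) = W_k[Ψ_m](f)`, and since the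
`Ψ_m` increase, this tends to `W_k[Ψ_∞](f)`. For `k = 1` the left side is `‖f‖² - ‖(D²_{A^m} f) *
χ‖²`. The last term vanishes in the limit: `D²_{A^m}` preserves the `L²` norm but multiplies the
`L¹` norm by `|det A|^{-m/2}`, where `|det A| > 1`, so Young's inequality and density apply
(`tendsto_conv_dilation2_zero`). Hence `Ψ_∞` is Parseval, and a Parseval family conserves energy at
every layer; the limit formula and `δ = 1` follow.

The same decay holds against each filter of `Ψ`. So for large `m`, adding `D²_{A^m} v` to `u` brings
the energy at every depth below neither that of `u` nor that of `D²_{A^m} v`, up to `ε`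
(`eventually_energyRemainder_le_add`). Adding to `g` dilates of `2^{-J} √E_1 g`, the `J`-th so
strongly dilated that it keeps its energy down to a prescribed depth, yields signals with
arbitrarily slow decay (`exists_slow_decay`).

For the last claim, `Y_E` is covered by countably many closed sets. A ball in one of them would
contain a signal decaying no faster than a multiple of `√E_N`, which is incompatible with a bound of
order `E_N`. -/

/-! ### Determinants and linear changes of variables. -/

theorem det_toEuclideanLin {d : ℕ} (A : Matrix (Fin d) (Fin d) ℝ) :
    LinearMap.det (Matrix.toEuclideanLin A) = A.det := by
  rw [show Matrix.toEuclideanLin A = Matrix.toLin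
    (PiLp.basisFun 2 ℝ (Fin d)) (PiLp.basisFun 2 ℝ (Fin d)) A from by
      rw [← Matrix.toLpLin_eq_toLin], LinearMap.det_toLin]

/-- The absolute determinant is the product of the singular values, each at least the smallest. `1 ≤
d` makes the product nonempty, hence the inequality strict. -/
theorem one_lt_abs_det {d : ℕ} (hd : 1 ≤ d) {A : Matrix (Fin d) (Fin d) ℝ}
    (hA : 1 < sigmaMin A) : 1 < |A.det| := by
  rw [← det_toEuclideanLin, ← LinearMap.normDet_eq_abs_det, LinearMap.normDet_eq_prod_singularValues,
    finrank_euclideanSpace_fin]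
  have h : ∀ i ∈ Finset.range d, 1 < (Matrix.toEuclideanLin A).singularValues i := fun i hi =>
    hA.trans_le ((Matrix.toEuclideanLin A).singularValues_antitone
      (Nat.le_sub_one_of_lt (Finset.mem_range.1 hi)))
  calc (1 : ℝ) = ∏ i ∈ Finset.range d, 1 := by simp
    _ < ∏ i ∈ Finset.range d, (Matrix.toEuclideanLin A).singularValues i :=
      Finset.prod_lt_prod_of_nonempty (fun _ _ => one_pos) h ⟨0, Finset.mem_range.2 hd⟩

theorem abs_det_pos {d : ℕ} (B : GL (Fin d) ℝ) :
    0 < |(B : Matrix (Fin d) (Fin d) ℝ).det| :=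
  abs_pos.2 (B.isUnit.map Matrix.detMonoidHom).ne_zero

theorem det_inv_coe {d : ℕ} (B : GL (Fin d) ℝ) :
    ((B⁻¹ : GL (Fin d) ℝ) : Matrix (Fin d) (Fin d) ℝ).det =
      (B : Matrix (Fin d) (Fin d) ℝ).det⁻¹ := by
  simp [Matrix.coe_units_inv, Matrix.det_nonsing_inv]

theorem act_act_inv {d : ℕ} (B : GL (Fin d) ℝ) (x : EuclideanSpace ℝ (Fin d)) :
    act B (act B⁻¹ x) = x := by
  have h : (B : Matrix (Fin d) (Fin d) ℝ) * ((B⁻¹ : GL (Fin d) ℝ) : Matrix (Fin d) (Fin d) ℝ)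
      = 1 := by
    rw [← Units.val_mul, mul_inv_cancel, Units.val_one]
  ext i
  simp only [act, Matrix.toLpLin_apply, Matrix.mulVec_mulVec, h, Matrix.one_mulVec]

theorem act_inv_act {d : ℕ} (B : GL (Fin d) ℝ) (x : EuclideanSpace ℝ (Fin d)) :
    act B⁻¹ (act B x) = x := by
  simpa using act_act_inv B⁻¹ x

theorem continuous_act {d : ℕ} (B : GL (Fin d) ℝ) : Continuous (act B) :=
  LinearMap.continuous_of_finiteDimensional _

theorem map_act {d : ℕ} (B : GL (Fin d) ℝ) :
    Measure.map (act B) (volume : Measure (EuclideanSpace ℝ (Fin d))) =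
      ENNReal.ofReal |(B : Matrix (Fin d) (Fin d) ℝ).det|⁻¹ • volume := by
  have h := Measure.map_linearMap_addHaar_eq_smul_addHaar
    (volume : Measure (EuclideanSpace ℝ (Fin d)))
    (f := Matrix.toEuclideanLin (B : Matrix (Fin d) (Fin d) ℝ))
    (by rw [det_toEuclideanLin]; exact abs_pos.1 (abs_det_pos B))
  rwa [det_toEuclideanLin, abs_inv] at h

theorem measurableEmbedding_act {d : ℕ} (B : GL (Fin d) ℝ) : MeasurableEmbedding (act B) :=
  (Homeomorph.mk ⟨act B, act B⁻¹, act_inv_act B, act_act_inv B⟩ (continuous_act B)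
    (continuous_act B⁻¹)).measurableEmbedding

theorem quasiMeasurePreserving_act {d : ℕ} (B : GL (Fin d) ℝ) :
    Measure.QuasiMeasurePreserving (act B) (volume : Measure (EuclideanSpace ℝ (Fin d))) volume :=
  ⟨(continuous_act B).measurable, by rw [map_act]; exact Measure.smul_absolutelyContinuous⟩

theorem lintegral_comp_act {d : ℕ} (B : GL (Fin d) ℝ) (F : EuclideanSpace ℝ (Fin d) → ℝ≥0∞) :
    ∫⁻ x, F (act B x) =
      ENNReal.ofReal |(B : Matrix (Fin d) (Fin d) ℝ).det|⁻¹ * ∫⁻ x, F x := by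
  rw [← (measurableEmbedding_act B).lintegral_map, map_act, lintegral_smul_measure, smul_eq_mul]

theorem integral_comp_act {d : ℕ} (B : GL (Fin d) ℝ) (F : EuclideanSpace ℝ (Fin d) → ℂ) :
    ∫ x, F (act B x) = (|(B : Matrix (Fin d) (Fin d) ℝ).det|⁻¹ : ℝ) • ∫ x, F x := by
  rw [← (measurableEmbedding_act B).integral_map, map_act, integral_smul_measure,
    ENNReal.toReal_ofReal (inv_nonneg.2 (abs_nonneg _))]

theorem enorm_complex_ofReal {r : ℝ} (hr : 0 ≤ r) : ‖(r : ℂ)‖ₑ = ENNReal.ofReal r := by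
  rw [← ofReal_norm, Complex.norm_real, Real.norm_of_nonneg hr]

theorem enorm_sq_eq_lintegral {d : ℕ} (f : L2 d) : ‖f‖ₑ ^ 2 = ∫⁻ x, ‖f x‖ₑ ^ 2 := by
  rw [Lp.enorm_def, eLpNorm_eq_lintegral_rpow_enorm_toReal (by norm_num) (by norm_num),
    ← ENNReal.rpow_natCast, ← ENNReal.rpow_mul]
  norm_num

/-! ### Convolution, propagators and their covariance under dilation. -/

theorem convFun_apply {d : ℕ} (f ψ : EuclideanSpace ℝ (Fin d) → ℂ) (x : EuclideanSpace ℝ (Fin d)) :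
    convFun f ψ x = ∫ t, f t * ψ (x - t) := by
  simp [convFun, convolution_def]

theorem convFun_congr {d : ℕ} {f f' ψ ψ' : EuclideanSpace ℝ (Fin d) → ℂ}
    (hf : f =ᵐ[volume] f') (hψ : ψ =ᵐ[volume] ψ') : convFun f ψ = convFun f' ψ' :=
  convolution_congr _ hf hψ

theorem coeFn_conv {d : ℕ} (f : L2 d) (ψ : FilterFn d) :
    conv f ψ =ᵐ[volume] convFun f ψ.1 :=
  MemLp.coeFn_toLp _

theorem coeFn_propagator {d : ℕ} (ψ : FilterFn d) (f : L2 d) :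
    propagator ψ f =ᵐ[volume] fun x => ((‖conv f ψ x‖ : ℝ) : ℂ) :=
  MemLp.coeFn_toLp _

theorem coeFn_dilation2 {d : ℕ} (B : GL (Fin d) ℝ) (f : L2 d) :
    dilation2 B f =ᵐ[volume]
      fun x => ((√|(B : Matrix (Fin d) (Fin d) ℝ).det| : ℝ) : ℂ) * f (act B x) :=
  MemLp.coeFn_toLp _

theorem coeFn_dilation1 {d : ℕ} (B : GL (Fin d) ℝ) (ψ : FilterFn d) :
    (dilation1 B ψ).1 =ᵐ[volume]
      fun x => ((|(B : Matrix (Fin d) (Fin d) ℝ).det| : ℝ) : ℂ) * ψ.1 (act B x) :=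
  ((memLp_comp_act B (Lp.memLp ψ.1)).const_mul _).coeFn_toLp

theorem integrable_conv_integrand {d : ℕ} {f ψ : EuclideanSpace ℝ (Fin d) → ℂ}
    (hf : MemLp f 2 volume) (hψ : MemLp ψ 2 volume) (x : EuclideanSpace ℝ (Fin d)) :
    Integrable (fun t => f t * ψ (x - t)) :=
  hf.integrable_mul (hψ.comp_measurePreserving (Measure.measurePreserving_sub_left volume x))

theorem conv_sub {d : ℕ} (f g : L2 d) (ψ : FilterFn d) :
    conv (f - g) ψ = conv f ψ - conv g ψ := by
  apply Lp.ext
  filter_upwards [coeFn_conv (f - g) ψ, coeFn_conv f ψ, coeFn_conv g ψ,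
    Lp.coeFn_sub (conv f ψ) (conv g ψ)] with x h1 h2 h3 h4
  rw [h1, h4, Pi.sub_apply, h2, h3, convFun_congr (Lp.coeFn_sub f g) (Filter.EventuallyEq.refl _ _)]
  simp only [convFun_apply, Pi.sub_apply, sub_mul]
  exact integral_sub (integrable_conv_integrand (Lp.memLp f) (Lp.memLp ψ.1) x)
    (integrable_conv_integrand (Lp.memLp g) (Lp.memLp ψ.1) x)

theorem norm_propagator {d : ℕ} (ψ : FilterFn d) (f : L2 d) : ‖propagator ψ f‖ = ‖conv f ψ‖ := by
  have h : ∀ᵐ x, ‖propagator ψ f x‖ = ‖conv f ψ x‖ := by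
    filter_upwards [coeFn_propagator ψ f] with x hx
    rw [hx, Complex.norm_real, norm_norm]
  exact le_antisymm (Lp.norm_le_norm_of_ae_le (h.mono fun _ hx => hx.le))
    (Lp.norm_le_norm_of_ae_le (h.mono fun _ hx => hx.ge))

theorem norm_propagator_sub_le {d : ℕ} (ψ : FilterFn d) (f g : L2 d) :
    ‖propagator ψ f - propagator ψ g‖ ≤ ‖conv (f - g) ψ‖ := by
  refine Lp.norm_le_norm_of_ae_le ?_
  rw [conv_sub]
  filter_upwards [coeFn_propagator ψ f, coeFn_propagator ψ g,
    Lp.coeFn_sub (propagator ψ f) (propagator ψ g), Lp.coeFn_sub (conv f ψ) (conv g ψ)]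
    with x h1 h2 h3 h4
  rw [h3, h4, Pi.sub_apply, Pi.sub_apply, h1, h2, ← Complex.ofReal_sub, Complex.norm_real]
  exact abs_norm_sub_norm_le _ _

theorem dilation2_sub {d : ℕ} (B : GL (Fin d) ℝ) (f g : L2 d) :
    dilation2 B (f - g) = dilation2 B f - dilation2 B g := by
  apply Lp.ext
  filter_upwards [coeFn_dilation2 B (f - g), coeFn_dilation2 B f, coeFn_dilation2 B g,
    Lp.coeFn_sub (dilation2 B f) (dilation2 B g),
    (quasiMeasurePreserving_act B).ae (Lp.coeFn_sub f g)] with x h1 h2 h3 h4 h5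
  rw [h1, h4, Pi.sub_apply, h2, h3, h5, Pi.sub_apply, mul_sub]

theorem norm_dilation2 {d : ℕ} (B : GL (Fin d) ℝ) (f : L2 d) : ‖dilation2 B f‖ = ‖f‖ := by
  have hB := abs_det_pos B
  have h : ‖dilation2 B f‖ₑ ^ 2 = ‖f‖ₑ ^ 2 := by
    rw [enorm_sq_eq_lintegral, enorm_sq_eq_lintegral]
    have h1 : ∫⁻ x, ‖dilation2 B f x‖ₑ ^ 2 =
        ∫⁻ x, ENNReal.ofReal |(B : Matrix (Fin d) (Fin d) ℝ).det| * ‖f (act B x)‖ₑ ^ 2 := by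
      refine lintegral_congr_ae ?_
      filter_upwards [coeFn_dilation2 B f] with x hx
      rw [hx, enorm_mul, mul_pow, enorm_complex_ofReal (Real.sqrt_nonneg _),
        ← ENNReal.ofReal_pow (Real.sqrt_nonneg _), Real.sq_sqrt hB.le]
    rw [h1, lintegral_const_mul' _ _ ENNReal.ofReal_ne_top,
      lintegral_comp_act B (fun x => ‖f x‖ₑ ^ 2), ← mul_assoc, ← ENNReal.ofReal_mul hB.le,
      mul_inv_cancel₀ hB.ne', ENNReal.ofReal_one, one_mul]
  have h2 := congrArg ENNReal.toReal h
  rw [ENNReal.toReal_pow, ENNReal.toReal_pow, toReal_enorm, toReal_enorm] at h2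
  exact (sq_eq_sq₀ (norm_nonneg _) (norm_nonneg _)).1 h2

theorem enorm_dilation2 {d : ℕ} (B : GL (Fin d) ℝ) (f : L2 d) : ‖dilation2 B f‖ₑ = ‖f‖ₑ := by
  rw [← ofReal_norm, norm_dilation2, ofReal_norm]

theorem dilation1_dilation1_inv {d : ℕ} (B : GL (Fin d) ℝ) (ψ : FilterFn d) :
    dilation1 B (dilation1 B⁻¹ ψ) = ψ := by
  apply Subtype.ext
  apply Lp.ext
  filter_upwards [coeFn_dilation1 B (dilation1 B⁻¹ ψ),
    (quasiMeasurePreserving_act B).ae (coeFn_dilation1 B⁻¹ ψ)] with x h1 h2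
  have hB := (abs_det_pos B).ne'
  rw [h1, h2, act_inv_act, det_inv_coe, abs_inv, ← mul_assoc, ← Complex.ofReal_mul,
    mul_inv_cancel₀ hB, Complex.ofReal_one, one_mul]

/-- Allows sums over `Ψ_m`, defined as an image, to be reindexed by `Ψ`. -/
theorem dilation1_injective {d : ℕ} (B : GL (Fin d) ℝ) : Function.Injective (dilation1 B) :=
  Function.LeftInverse.injective (g := dilation1 B⁻¹) fun ψ => by
    simpa using dilation1_dilation1_inv B⁻¹ ψ

/-- Substituting `s = B t` produces the Jacobian `|det B|⁻¹`, which is exactly the normalisation of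
`D¹_{B⁻¹}`. -/
theorem conv_dilation2 {d : ℕ} (B : GL (Fin d) ℝ) (f : L2 d) (ψ : FilterFn d) :
    conv (dilation2 B f) ψ = dilation2 B (conv f (dilation1 B⁻¹ ψ)) := by
  apply Lp.ext
  filter_upwards [coeFn_conv (dilation2 B f) ψ, coeFn_dilation2 B (conv f (dilation1 B⁻¹ ψ)),
    (quasiMeasurePreserving_act B).ae (coeFn_conv f (dilation1 B⁻¹ ψ))] with x h1 h2 h3
  rw [h1, h2, h3, convFun_congr (coeFn_dilation2 B f) (Filter.EventuallyEq.refl _ _),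
    convFun_congr (Filter.EventuallyEq.refl _ f) (coeFn_dilation1 B⁻¹ ψ), convFun_apply,
    convFun_apply, det_inv_coe, abs_inv]
  have h4 := integral_comp_act B (fun t => f t * ψ.1 (act B⁻¹ (act B x - t)))
  have h5 : ∀ t, act B⁻¹ (act B x - act B t) = x - t := fun t => by
    rw [act, map_sub]; exact congrArg₂ _ (act_inv_act B x) (act_inv_act B t)
  simp only [h5] at h4
  simp only [mul_assoc, integral_const_mul, h4, Complex.real_smul]
  simp only [mul_left_comm _ (((|(B : Matrix (Fin d) (Fin d) ℝ).det|⁻¹ : ℝ) : ℂ)),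
    integral_const_mul]

theorem propagator_dilation2 {d : ℕ} (B : GL (Fin d) ℝ) (f : L2 d) (ψ : FilterFn d) :
    propagator ψ (dilation2 B f) = dilation2 B (propagator (dilation1 B⁻¹ ψ) f) := by
  apply Lp.ext
  filter_upwards [coeFn_propagator ψ (dilation2 B f),
    coeFn_dilation2 B (propagator (dilation1 B⁻¹ ψ) f),
    (quasiMeasurePreserving_act B).ae (coeFn_propagator (dilation1 B⁻¹ ψ) f),
    coeFn_dilation2 B (conv f (dilation1 B⁻¹ ψ))] with x h1 h2 h3 h4
  rw [h1, h2, h3, conv_dilation2, h4, norm_mul, Complex.norm_real, Real.norm_eq_abs,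
    abs_of_nonneg (Real.sqrt_nonneg _), Complex.ofReal_mul]

theorem pathPropagator_dilation2 {d : ℕ} (B : GL (Fin d) ℝ) (N : ℕ) (p : Fin N → FilterFn d)
    (f : L2 d) :
    pathPropagator N p (dilation2 B f) =
      dilation2 B (pathPropagator N (fun i => dilation1 B⁻¹ (p i)) f) := by
  induction N generalizing f with
  | zero => rfl
  | succ N ih =>
    rw [pathPropagator, propagator_dilation2, ih]
    rfl

/-! ### Decay of filtered dilates. -/

/-- Young's inequality `‖f * ψ‖₂ ≤ ‖f‖₁ ‖ψ‖₂`. -/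
theorem enorm_conv_sq_le {d : ℕ} (f : L2 d) (ψ : FilterFn d) :
    ‖conv f ψ‖ₑ ^ 2 ≤ (∫⁻ x, ‖f x‖ₑ) ^ 2 * ‖ψ.1‖ₑ ^ 2 := by
  rcases eq_or_ne (∫⁻ x, ‖f x‖ₑ) ∞ with hf1 | hf1
  -- For `‖f‖₁ = ∞` the bound is trivial unless `ψ = 0`, where `∞ * 0 = 0` and the convolution
  -- itself has to vanish.
  · rcases eq_or_ne (‖ψ.1‖ₑ) 0 with h0 | h0
    · have hz : ψ.1 = 0 := by simpa using h0
      have : conv f ψ = 0 := by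
        apply Lp.ext
        filter_upwards [coeFn_conv f ψ, Lp.coeFn_zero ℂ 2
          (volume : Measure (EuclideanSpace ℝ (Fin d)))] with x h1 h2
        rw [h1, h2, hz, convFun_congr (Filter.EventuallyEq.refl _ f) (Lp.coeFn_zero ℂ 2
          (volume : Measure (EuclideanSpace ℝ (Fin d)))), convFun_apply]
        simp
      simp [this]
    · rw [hf1]; simp [ENNReal.top_mul, h0]
  have hm : AEMeasurable
      (fun p : EuclideanSpace ℝ (Fin d) × EuclideanSpace ℝ (Fin d) =>
        ‖ψ.1 (p.1 - p.2)‖ₑ ^ 2 * ‖f p.2‖ₑ) (volume.prod volume) := by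
    have h1 := ((Lp.aestronglyMeasurable ψ.1).comp_quasiMeasurePreserving
        (quasiMeasurePreserving_sub_of_right_invariant volume volume)).enorm.pow_const 2
    exact h1.mul (Lp.aestronglyMeasurable f).comp_snd.enorm
  calc ‖conv f ψ‖ₑ ^ 2 = ∫⁻ x, ‖convFun f ψ.1 x‖ₑ ^ 2 := by
        rw [enorm_sq_eq_lintegral]
        refine lintegral_congr_ae ?_
        filter_upwards [coeFn_conv f ψ] with x hx
        rw [hx]
    -- Cauchy-Schwarz with density `|f|` puts the `L²` norm on `ψ`.
    _ ≤ ∫⁻ x, (∫⁻ t, ‖ψ.1 (x - t)‖ₑ ^ 2 * ‖f t‖ₑ) * ∫⁻ t, ‖f t‖ₑ := by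
        refine lintegral_mono fun x => ?_
        refine (pow_le_pow_left' ?_ 2).trans (lintegral_mul_sq_le
          ((Lp.aestronglyMeasurable ψ.1).comp_quasiMeasurePreserving
            (quasiMeasurePreserving_sub_left volume x)).enorm (Lp.aestronglyMeasurable f).enorm)
        rw [convFun_apply]
        refine (enorm_integral_le_lintegral_enorm _).trans (le_of_eq ?_)
        simp only [enorm_mul, mul_comm]
    _ = (∫⁻ x, ∫⁻ t, ‖ψ.1 (x - t)‖ₑ ^ 2 * ‖f t‖ₑ) * ∫⁻ t, ‖f t‖ₑ :=
        lintegral_mul_const' _ _ hf1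
    _ = (∫⁻ t, ∫⁻ x, ‖ψ.1 (x - t)‖ₑ ^ 2 * ‖f t‖ₑ) * ∫⁻ t, ‖f t‖ₑ := by
        rw [lintegral_lintegral_swap hm]
    _ = (‖ψ.1‖ₑ ^ 2 * ∫⁻ t, ‖f t‖ₑ) * ∫⁻ t, ‖f t‖ₑ := by
        congr 1
        rw [← lintegral_const_mul' _ _ (by simp), enorm_sq_eq_lintegral]
        refine lintegral_congr fun t => ?_
        rw [lintegral_mul_const' _ _ (by simp),
          lintegral_sub_right_eq_self (fun x => ‖ψ.1 x‖ₑ ^ 2) t]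
    _ = _ := by ring

theorem lintegral_enorm_dilation2 {d : ℕ} (B : GL (Fin d) ℝ) (f : L2 d) :
    ∫⁻ x, ‖dilation2 B f x‖ₑ =
      ENNReal.ofReal (√|(B : Matrix (Fin d) (Fin d) ℝ).det|)⁻¹ * ∫⁻ x, ‖f x‖ₑ := by
  have hB := abs_det_pos B
  have h1 : ∫⁻ x, ‖dilation2 B f x‖ₑ =
      ∫⁻ x, ENNReal.ofReal (√|(B : Matrix (Fin d) (Fin d) ℝ).det|) * ‖f (act B x)‖ₑ := by
    refine lintegral_congr_ae ?_
    filter_upwards [coeFn_dilation2 B f] with x hx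
    rw [hx, enorm_mul, enorm_complex_ofReal (Real.sqrt_nonneg _)]
  rw [h1, lintegral_const_mul' _ _ ENNReal.ofReal_ne_top,
    lintegral_comp_act B (fun x => ‖f x‖ₑ), ← mul_assoc, ← ENNReal.ofReal_mul (Real.sqrt_nonneg _)]
  congr 2
  have hs := Real.sqrt_pos.2 hB
  field_simp
  exact (Real.sq_sqrt hB.le)

theorem exists_lintegral_enorm_ne_top_norm_sub_lt {d : ℕ} (h : L2 d) {ε : ℝ} (hε : 0 < ε) :
    ∃ g : L2 d, ∫⁻ x, ‖g x‖ₑ ≠ ∞ ∧ ‖h - g‖ < ε := by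
  obtain ⟨g, hgs, hg, hgc, hgm⟩ := (Lp.memLp h).exists_hasCompactSupport_eLpNorm_sub_le
    (by norm_num) (ENNReal.ofReal_pos.2 (half_pos hε)).ne'
  refine ⟨hgm.toLp g, ?_, ?_⟩
  · rw [lintegral_congr_ae (g := fun x => ‖g x‖ₑ)
      (by filter_upwards [hgm.coeFn_toLp] with x hx using by rw [hx])]
    exact (hgc.integrable_of_hasCompactSupport hgs).2.ne
  · refine lt_of_le_of_lt ?_ (half_lt_self hε)
    rw [Lp.norm_def]
    refine ENNReal.toReal_le_of_le_ofReal (half_pos hε).le (le_trans (le_of_eq ?_) hg)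
    refine eLpNorm_congr_ae ?_
    filter_upwards [hgm.coeFn_toLp, Lp.coeFn_sub h (hgm.toLp g)] with x h1 h2
    rw [h2, Pi.sub_apply, Pi.sub_apply, h1]

/-- For `g ∈ L¹ ∩ L²`, Young's inequality gives squared norms of order `|det A|^{-m}`. Density
extends this to `h`, because dilation is isometric and convolution with `ψ` contracts. It is used
for `χ` and for every filter in `Ψ`. -/
theorem tendsto_conv_dilation2_zero {d : ℕ} {A : GL (Fin d) ℝ}
    (hA : 1 < |(A : Matrix (Fin d) (Fin d) ℝ).det|) {ψ : FilterFn d}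
    (hψ : ∀ f : L2 d, ‖conv f ψ‖ ≤ ‖f‖) (h : L2 d) :
    Filter.Tendsto (fun m : ℕ => conv (dilation2 (A ^ m) h) ψ) Filter.atTop (𝓝 0) := by
  rw [NormedAddGroup.tendsto_nhds_zero]
  intro ε hε
  obtain ⟨g, hg1, hg2⟩ := exists_lintegral_enorm_ne_top_norm_sub_lt h (half_pos hε)
  set K : ℝ := (∫⁻ x, ‖g x‖ₑ).toReal ^ 2 * ‖ψ.1‖ ^ 2 with hK
  have hbound : ∀ m : ℕ, ‖conv (dilation2 (A ^ m) g) ψ‖ ^ 2 ≤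
      (|(A : Matrix (Fin d) (Fin d) ℝ).det|⁻¹) ^ m * K := by
    intro m
    have h1 := enorm_conv_sq_le (dilation2 (A ^ m) g) ψ
    rw [lintegral_enorm_dilation2] at h1
    have h2 := ENNReal.toReal_mono (by finiteness) h1
    rw [ENNReal.toReal_mul, ENNReal.toReal_pow, ENNReal.toReal_pow, ENNReal.toReal_pow,
      ENNReal.toReal_mul, toReal_enorm, toReal_enorm,
      ENNReal.toReal_ofReal (inv_nonneg.2 (Real.sqrt_nonneg _)), mul_pow, inv_pow,
      Real.sq_sqrt (abs_nonneg _), Units.val_pow_eq_pow_val, Matrix.det_pow, abs_pow] at h2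
    rwa [inv_pow, hK, ← mul_assoc]
  have hlim : Filter.Tendsto (fun m : ℕ => (|(A : Matrix (Fin d) (Fin d) ℝ).det|⁻¹) ^ m * K)
      Filter.atTop (𝓝 0) := by
    simpa using (tendsto_pow_atTop_nhds_zero_of_lt_one (inv_nonneg.2 (abs_nonneg _))
      (inv_lt_one_of_one_lt₀ hA)).mul_const K
  filter_upwards [hlim.eventually (gt_mem_nhds (pow_pos (half_pos hε) 2))] with m hm
  have h1 : ‖conv (dilation2 (A ^ m) g) ψ‖ < ε / 2 :=
    lt_of_pow_lt_pow_left₀ 2 (half_pos hε).le ((hbound m).trans_lt hm)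
  have h2 : ‖conv (dilation2 (A ^ m) h) ψ - conv (dilation2 (A ^ m) g) ψ‖ < ε / 2 := by
    rw [← conv_sub, ← dilation2_sub]
    exact ((hψ _).trans_eq (norm_dilation2 _ _)).trans_lt hg2
  have h3 := norm_add_le (conv (dilation2 (A ^ m) h) ψ - conv (dilation2 (A ^ m) g) ψ)
    (conv (dilation2 (A ^ m) g) ψ)
  rw [sub_add_cancel] at h3
  linarith

end Scattering

/-! ### Energy along paths, for Bessel and Parseval families. -/

namespace Scattering

/-- The Bessel condition `∑_{ψ ∈ Φ} ‖f * ψ‖² ≤ ‖f‖²` for all `f`. -/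
def IsBessel {d : ℕ} (Φ : Set (FilterFn d)) : Prop :=
  ∀ f : L2 d, ∑' ψ : Φ, ‖conv f ψ‖ₑ ^ 2 ≤ ‖f‖ₑ ^ 2

theorem IsBessel.enorm_conv_sq_le {d : ℕ} {Φ : Set (FilterFn d)} (hΦ : IsBessel Φ) (f : L2 d)
    (ψ : Φ) : ‖conv f ψ‖ₑ ^ 2 ≤ ‖f‖ₑ ^ 2 :=
  (ENNReal.le_tsum ψ).trans (hΦ f)

theorem enorm_propagator {d : ℕ} (ψ : FilterFn d) (f : L2 d) : ‖propagator ψ f‖ₑ = ‖conv f ψ‖ₑ := by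
  rw [← ofReal_norm, norm_propagator, ofReal_norm]

theorem enorm_propagator_sub_le {d : ℕ} (ψ : FilterFn d) (f g : L2 d) :
    ‖propagator ψ f - propagator ψ g‖ₑ ≤ ‖conv (f - g) ψ‖ₑ := by
  rw [← ofReal_norm, ← ofReal_norm]
  exact ENNReal.ofReal_le_ofReal (norm_propagator_sub_le ψ f g)

/-- Peels off the first filter, matching the recursion of `pathPropagator`; this drives the
inductions on path length. -/
theorem tsum_path_succ {α : Type*} {N : ℕ} (F : (Fin (N + 1) → α) → ℝ≥0∞) :
    ∑' p, F p = ∑' (a : α) (p : Fin N → α), F (Fin.cons a p) := by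
  rw [← (Fin.consEquiv (fun _ => α)).tsum_eq, ENNReal.tsum_prod']
  rfl

theorem energyRemainder_zero {d : ℕ} (Φ : Set (FilterFn d)) (f : L2 d) :
    energyRemainder Φ 0 f = ‖f‖ₑ ^ 2 := by
  simp [energyRemainder, pathPropagator]

theorem pathPropagator_cons {d N : ℕ} {Φ : Set (FilterFn d)} (ψ : Φ) (p : Fin N → Φ) (f : L2 d) :
    pathPropagator (N + 1) (fun i => ((Fin.cons ψ p : Fin (N + 1) → Φ) i : FilterFn d)) f =
      pathPropagator N (fun i => (p i : FilterFn d)) (propagator ψ f) :=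
  rfl

theorem energyRemainder_succ {d : ℕ} (Φ : Set (FilterFn d)) (N : ℕ) (f : L2 d) :
    energyRemainder Φ (N + 1) f = ∑' ψ : Φ, energyRemainder Φ N (propagator ψ f) := by
  rw [energyRemainder, tsum_path_succ]
  rfl

theorem IsBessel.energyRemainder_succ_le {d : ℕ} {Φ : Set (FilterFn d)} (hΦ : IsBessel Φ) (N : ℕ)
    (f : L2 d) : energyRemainder Φ (N + 1) f ≤ energyRemainder Φ N f := by
  induction N generalizing f with
  | zero =>
    simpa only [energyRemainder_succ, energyRemainder_zero, enorm_propagator] using hΦ f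
  | succ N ih =>
    rw [energyRemainder_succ Φ (N + 1), energyRemainder_succ Φ N]
    exact ENNReal.tsum_le_tsum fun ψ => ih _

theorem IsBessel.energyRemainder_antitone {d : ℕ} {Φ : Set (FilterFn d)} (hΦ : IsBessel Φ)
    (f : L2 d) : Antitone fun N => energyRemainder Φ N f :=
  antitone_nat_of_succ_le fun N => hΦ.energyRemainder_succ_le N f

theorem IsBessel.energyRemainder_le {d : ℕ} {Φ : Set (FilterFn d)} (hΦ : IsBessel Φ) (N : ℕ)
    (f : L2 d) : energyRemainder Φ N f ≤ ‖f‖ₑ ^ 2 :=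
  (hΦ.energyRemainder_antitone f (Nat.zero_le N)).trans_eq (energyRemainder_zero Φ f)

theorem energyRemainder_eq_of_parseval {d : ℕ} {Φ : Set (FilterFn d)}
    (hΦ : ∀ f : L2 d, ∑' ψ : Φ, ‖conv f ψ‖ₑ ^ 2 = ‖f‖ₑ ^ 2) (N : ℕ) (f : L2 d) :
    energyRemainder Φ N f = ‖f‖ₑ ^ 2 := by
  induction N generalizing f with
  | zero => exact energyRemainder_zero Φ f
  | succ N ih => simp only [energyRemainder_succ, ih, enorm_propagator, hΦ]

/-- Scattering propagators along all paths of a fixed length are jointly nonexpansive. -/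
theorem IsBessel.tsum_pathPropagator_sub_le {d : ℕ} {Φ : Set (FilterFn d)} (hΦ : IsBessel Φ)
    (N : ℕ) (f g : L2 d) :
    ∑' p : Fin N → Φ, ‖pathPropagator N (fun i => (p i : FilterFn d)) f -
      pathPropagator N (fun i => (p i : FilterFn d)) g‖ₑ ^ 2 ≤ ‖f - g‖ₑ ^ 2 := by
  induction N generalizing f g with
  | zero => simp [pathPropagator]
  | succ N ih =>
    rw [tsum_path_succ]
    simp only [pathPropagator_cons]
    exact (ENNReal.tsum_le_tsum fun ψ => (ih _ _).trans
      (pow_le_pow_left' (enorm_propagator_sub_le _ _ _) 2)).trans (hΦ _)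

/-- The free parameter `t` lets the factor of `‖y‖²` approach `1`, so that comparing energies costs
arbitrarily little. -/
theorem enorm_sq_le_add {E : Type*} [SeminormedAddCommGroup E] (x y : E) {t : ℝ} (ht : 0 < t) :
    ‖x‖ₑ ^ 2 ≤ ENNReal.ofReal (1 + t) * ‖y‖ₑ ^ 2 + ENNReal.ofReal (1 + t⁻¹) * ‖x - y‖ₑ ^ 2 := by
  have h1 : ‖x‖ ≤ ‖y‖ + ‖x - y‖ := by simpa using norm_add_le y (x - y)
  have h2 : ‖x‖ ^ 2 ≤ (1 + t) * ‖y‖ ^ 2 + (1 + t⁻¹) * ‖x - y‖ ^ 2 := by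
    refine (pow_le_pow_left₀ (norm_nonneg x) h1 2).trans ?_
    have h3 : 0 ≤ t⁻¹ * (t * ‖y‖ - ‖x - y‖) ^ 2 := by positivity
    have h4 : t⁻¹ * (t * ‖y‖ - ‖x - y‖) ^ 2 =
        t * ‖y‖ ^ 2 - 2 * (‖y‖ * ‖x - y‖) + t⁻¹ * ‖x - y‖ ^ 2 := by
      field_simp
      ring
    nlinarith
  simp only [← ofReal_norm, ← ENNReal.ofReal_pow (norm_nonneg _)]
  rw [← ENNReal.ofReal_mul (by positivity), ← ENNReal.ofReal_mul (by positivity),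
    ← ENNReal.ofReal_add (by positivity) (by positivity)]
  exact ENNReal.ofReal_le_ofReal h2

theorem IsBessel.energyRemainder_le_add {d : ℕ} {Φ : Set (FilterFn d)} (hΦ : IsBessel Φ)
    (N : ℕ) (f g : L2 d) {t : ℝ} (ht : 0 < t) :
    energyRemainder Φ N f ≤ ENNReal.ofReal (1 + t) * energyRemainder Φ N g +
      ENNReal.ofReal (1 + t⁻¹) * ‖f - g‖ₑ ^ 2 := by
  have h := ENNReal.tsum_le_tsum fun p : Fin N → Φ =>
    enorm_sq_le_add (pathPropagator N (fun i => (p i : FilterFn d)) f)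
      (pathPropagator N (fun i => (p i : FilterFn d)) g) ht
  rw [ENNReal.tsum_add, ENNReal.tsum_mul_left, ENNReal.tsum_mul_left] at h
  refine h.trans ?_
  rw [energyRemainder]
  gcongr
  exact hΦ.tsum_pathPropagator_sub_le N f g

theorem energyRemainder_mono {d : ℕ} {Φ Φ' : Set (FilterFn d)} (h : Φ ⊆ Φ') (N : ℕ) (f : L2 d) :
    energyRemainder Φ N f ≤ energyRemainder Φ' N f :=
  ENNReal.tsum_comp_le_tsum_of_injective
    (f := fun p : Fin N → Φ => fun i => (⟨p i, h (p i).2⟩ : Φ'))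
    (fun _ _ hpq => funext fun i => Subtype.ext (Subtype.mk.inj (congrFun hpq i)))
    (fun p : Fin N → Φ' => ‖pathPropagator N (fun i => (p i : FilterFn d)) f‖ₑ ^ 2)

/-- A finite set of paths of length `N` uses finitely many filters, all of which lie in a single `S
m`; so the energy of the union is the supremum. -/
theorem tendsto_energyRemainder_iUnion {d : ℕ} {S : ℕ → Set (FilterFn d)} (hS : Monotone S)
    (N : ℕ) (f : L2 d) :
    Filter.Tendsto (fun m => energyRemainder (S m) N f) Filter.atTop
      (𝓝 (energyRemainder (⋃ m, S m) N f)) := by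
  have h : energyRemainder (⋃ m, S m) N f = ⨆ m, energyRemainder (S m) N f := by
    refine le_antisymm ?_ (iSup_le fun m => energyRemainder_mono (Set.subset_iUnion S m) N f)
    rw [energyRemainder, ENNReal.tsum_eq_iSup_sum]
    refine iSup_le fun F => ?_
    have hp : ∀ p : Fin N → ⋃ m, S m, ∃ m, ∀ i, (p i : FilterFn d) ∈ S m := by
      intro p
      choose n hn using fun i => Set.mem_iUnion.1 (p i).2
      exact ⟨Finset.univ.sup n, fun i => hS (Finset.le_sup (Finset.mem_univ i)) (hn i)⟩
    choose n hn using hp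
    refine le_trans ?_ (le_iSup _ (F.sup n))
    have hF : ∀ p : F, ∀ i, ((p : Fin N → ⋃ m, S m) i : FilterFn d) ∈ S (F.sup n) :=
      fun p i => hS (Finset.le_sup p.2) (hn p i)
    rw [← Finset.sum_coe_sort, ← tsum_fintype (L := .unconditional _)]
    exact ENNReal.tsum_comp_le_tsum_of_injective
      (f := fun p : F => fun i => (⟨_, hF p i⟩ : S (F.sup n)))
      (fun p q hpq => Subtype.ext <| funext fun i => Subtype.ext
        (Subtype.mk.inj (congrFun hpq i)))
      (fun p : Fin N → S (F.sup n) => ‖pathPropagator N (fun i => (p i : FilterFn d)) f‖ₑ ^ 2)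
  rw [h]
  exact tendsto_atTop_iSup fun m n hmn => energyRemainder_mono (hS hmn) N f

theorem energyRemainder_dilation2 {d : ℕ} (A : GL (Fin d) ℝ) (Ψ : Set (FilterFn d)) (m N : ℕ)
    (f : L2 d) :
    energyRemainder Ψ N (dilation2 (A ^ m) f) = energyRemainder (dilatedFilters A Ψ m) N f := by
  let e : Ψ ≃ dilatedFilters A Ψ m :=
    Equiv.Set.image (dilation1 (A ^ m)⁻¹) Ψ (dilation1_injective _)
  rw [energyRemainder, energyRemainder, ← (Equiv.piCongrRight fun _ : Fin N => e).tsum_eq]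
  refine tsum_congr fun p => ?_
  rw [pathPropagator_dilation2, enorm_dilation2]
  rfl

/-! ### Consequences of the filter bank identity: `Ψ_∞` is Parseval. -/

section FilterBank

variable {d : ℕ} {χ : FilterFn d} {Ψ : Set (FilterFn d)}

theorem IsFilterBank.hasSum (h : IsFilterBank χ Ψ) (f : L2 d) :
    HasSum (fun ψ : Ψ => ‖conv f ψ‖ ^ 2) (‖f‖ ^ 2 - ‖conv f χ‖ ^ 2) := by
  have h1 := h.parseval.2 f
  have h3 : Summable (fun ψ : Ψ => ‖conv f ψ‖ ^ 2) := by
    simpa [Function.comp_def] using h1.summable.comp_injective (Option.some_injective _)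
  have h4 : HasSum (fun o : Option Ψ =>
      ‖conv f (o.elim χ (fun ψ => (ψ : FilterFn d)))‖ ^ 2)
      ((∑' ψ : Ψ, ‖conv f ψ‖ ^ 2) + ‖conv f χ‖ ^ 2) := by
    rw [← (Equiv.optionEquivSumPUnit.{0} Ψ).symm.hasSum_iff]
    refine HasSum.sum h3.hasSum ?_
    exact hasSum_unique (fun _ : PUnit.{1} => ‖conv f χ‖ ^ 2)
  rw [h1.unique h4, add_sub_cancel_right]
  exact h3.hasSum

theorem IsFilterBank.tsum_enorm_sq (h : IsFilterBank χ Ψ) (f : L2 d) :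
    ∑' ψ : Ψ, ‖conv f ψ‖ₑ ^ 2 = ENNReal.ofReal (‖f‖ ^ 2 - ‖conv f χ‖ ^ 2) := by
  rw [← (h.hasSum f).tsum_eq, ENNReal.ofReal_tsum_of_nonneg (fun _ => by positivity)
    (h.hasSum f).summable]
  simp only [ENNReal.ofReal_pow (norm_nonneg _), ofReal_norm]

theorem IsFilterBank.isBessel (h : IsFilterBank χ Ψ) : IsBessel Ψ := fun f => by
  rw [h.tsum_enorm_sq, ← ofReal_norm, ← ENNReal.ofReal_pow (norm_nonneg _)]
  exact ENNReal.ofReal_le_ofReal (sub_le_self _ (by positivity))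

theorem IsFilterBank.norm_conv_le (h : IsFilterBank χ Ψ) (f : L2 d) : ‖conv f χ‖ ≤ ‖f‖ :=
  le_of_sq_le_sq (sub_nonneg.1 ((h.hasSum f).nonneg fun _ => by positivity)) (norm_nonneg _)

theorem IsBessel.norm_conv_le (h : IsBessel Ψ) (ψ : Ψ) (f : L2 d) : ‖conv f ψ‖ ≤ ‖f‖ := by
  have h1 := ENNReal.toReal_mono (by finiteness) (h.enorm_conv_sq_le f ψ)
  rw [ENNReal.toReal_pow, ENNReal.toReal_pow, toReal_enorm, toReal_enorm] at h1
  exact le_of_sq_le_sq h1 (norm_nonneg _)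

/-- The index is shifted because the inclusions start at `m = 1`. -/
theorem dilatedFilters_monotone {A : GL (Fin d) ℝ}
    (hincl : ∀ m : ℕ, 1 ≤ m → dilatedFilters A Ψ m ⊆ dilatedFilters A Ψ (m + 1)) :
    Monotone fun m => dilatedFilters A Ψ (m + 1) :=
  monotone_nat_of_le_succ fun m => hincl (m + 1) (Nat.le_add_left 1 m)

theorem unionDilatedFilters_eq (A : GL (Fin d) ℝ) (Ψ : Set (FilterFn d)) :
    unionDilatedFilters A Ψ = ⋃ m, dilatedFilters A Ψ (m + 1) := by
  ext φ
  simp only [unionDilatedFilters, Set.mem_iUnion, Set.mem_Ici, exists_prop]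
  exact ⟨fun ⟨m, hm, h⟩ => ⟨m - 1, by rwa [Nat.sub_add_cancel hm]⟩,
    fun ⟨m, h⟩ => ⟨m + 1, Nat.le_add_left 1 m, h⟩⟩

theorem tendsto_energyRemainder_dilation2_union {A : GL (Fin d) ℝ}
    (hincl : ∀ m : ℕ, 1 ≤ m → dilatedFilters A Ψ m ⊆ dilatedFilters A Ψ (m + 1)) (N : ℕ)
    (f : L2 d) :
    Filter.Tendsto (fun m : ℕ => energyRemainder Ψ N (dilation2 (A ^ m) f)) Filter.atTop
      (𝓝 (energyRemainder (unionDilatedFilters A Ψ) N f)) := by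
  rw [← Filter.tendsto_add_atTop_iff_nat 1, unionDilatedFilters_eq]
  simp only [energyRemainder_dilation2]
  exact tendsto_energyRemainder_iUnion (dilatedFilters_monotone hincl) N f

theorem energyRemainder_one (Φ : Set (FilterFn d)) (f : L2 d) :
    energyRemainder Φ 1 f = ∑' ψ : Φ, ‖conv f ψ‖ₑ ^ 2 := by
  simp only [energyRemainder_succ, energyRemainder_zero, enorm_propagator]

/-- Both sides are limits of `W_1[Ψ](D²_{A^m} f)`: one by exhaustion of `Ψ_∞`, the other because the
`χ` term dies out. -/
theorem IsFilterBank.tsum_unionDilatedFilters (h : IsFilterBank χ Ψ) {A : GL (Fin d) ℝ}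
    (hA : 1 < |(A : Matrix (Fin d) (Fin d) ℝ).det|)
    (hincl : ∀ m : ℕ, 1 ≤ m → dilatedFilters A Ψ m ⊆ dilatedFilters A Ψ (m + 1)) (f : L2 d) :
    ∑' ψ : unionDilatedFilters A Ψ, ‖conv f ψ‖ₑ ^ 2 = ‖f‖ₑ ^ 2 := by
  rw [← energyRemainder_one]
  refine tendsto_nhds_unique (tendsto_energyRemainder_dilation2_union hincl 1 f) ?_
  simp only [energyRemainder_one, h.tsum_enorm_sq, norm_dilation2]
  have h1 := ((tendsto_conv_dilation2_zero hA h.norm_conv_le f).norm.pow 2).const_sub (‖f‖ ^ 2)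
  have h2 := ENNReal.tendsto_ofReal h1
  simpa [ENNReal.ofReal_pow] using h2

theorem IsFilterBank.tendsto_energyRemainder (h : IsFilterBank χ Ψ) {A : GL (Fin d) ℝ}
    (hA : 1 < |(A : Matrix (Fin d) (Fin d) ℝ).det|)
    (hincl : ∀ m : ℕ, 1 ≤ m → dilatedFilters A Ψ m ⊆ dilatedFilters A Ψ (m + 1)) (f : L2 d)
    (N : ℕ) :
    Filter.Tendsto (fun m : ℕ => energyRemainder Ψ N (dilation2 (A ^ m) f)) Filter.atTop
      (𝓝 (‖f‖ₑ ^ 2)) := by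
  have h1 := tendsto_energyRemainder_dilation2_union hincl N f
  rwa [energyRemainder_eq_of_parseval (h.tsum_unionDilatedFilters hA hincl)] at h1

theorem IsFilterBank.countable (h : IsFilterBank χ Ψ) : Ψ.Countable :=
  have := h.parseval.1
  (Option.some_injective Ψ).countable

theorem IsFilterBank.isSemiDiscreteParsevalFrame_union (h : IsFilterBank χ Ψ) {A : GL (Fin d) ℝ}
    (hA : 1 < |(A : Matrix (Fin d) (Fin d) ℝ).det|)
    (hincl : ∀ m : ℕ, 1 ≤ m → dilatedFilters A Ψ m ⊆ dilatedFilters A Ψ (m + 1)) :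
    IsSemiDiscreteParsevalFrame
      (fun ψ : unionDilatedFilters A Ψ => (ψ : FilterFn d)) := by
  refine ⟨?_, fun f => ?_⟩
  · rw [unionDilatedFilters_eq]
    exact (Set.countable_iUnion fun m => h.countable.image _).to_subtype
  · have h1 := h.tsum_unionDilatedFilters hA hincl f
    have h2 := ENNReal.hasSum_toReal
      (f := fun ψ : unionDilatedFilters A Ψ => ‖conv f ψ‖ₑ ^ 2) (by rw [h1]; finiteness)
    rw [← ENNReal.tsum_toReal_eq (fun _ => by finiteness), h1] at h2
    simpa using h2

end FilterBank

end Scattering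

namespace Scattering

/-! ### Perturbations that asymptotically vanish under each filter. -/

section Perturbation

variable {d : ℕ} {Φ : Set (FilterFn d)}

/-- Each first-layer filter admits two estimates: bound its whole branch by `‖u * ψ‖²`, or compare
with `u + v` at cost `‖v * ψ‖²`. Taking the cheaper one gives an error term independent of `N`. -/
theorem IsBessel.energyRemainder_succ_le_add (hΦ : IsBessel Φ) (N : ℕ) (u v : L2 d) {t : ℝ}
    (ht : 0 < t) :
    energyRemainder Φ (N + 1) u ≤ ENNReal.ofReal (1 + t) * energyRemainder Φ (N + 1) (u + v) +
      ENNReal.ofReal (1 + t⁻¹) *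
        ∑' ψ : Φ, min (‖conv u ψ‖ₑ ^ 2) (‖conv v ψ‖ₑ ^ 2) := by
  rw [energyRemainder_succ, energyRemainder_succ, ← ENNReal.tsum_mul_left,
    ← ENNReal.tsum_mul_left, ← ENNReal.tsum_add]
  refine ENNReal.tsum_le_tsum fun ψ => ?_
  rcases min_cases (‖conv u ψ‖ₑ ^ 2) (‖conv v ψ‖ₑ ^ 2) with h | h
  · rw [h.1]
    have h1 : energyRemainder Φ N (propagator ψ u) ≤ ‖conv u ψ‖ₑ ^ 2 := by
      simpa only [enorm_propagator] using hΦ.energyRemainder_le N (propagator ψ u)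
    have h2 : (1 : ℝ≥0∞) ≤ ENNReal.ofReal (1 + t⁻¹) := by
      rw [ENNReal.one_le_ofReal]
      linarith [inv_pos.2 ht]
    exact h1.trans ((le_mul_of_one_le_left' h2).trans le_add_self)
  · rw [h.1]
    refine (hΦ.energyRemainder_le_add N _ (propagator ψ (u + v)) ht).trans ?_
    gcongr
    rw [← enorm_neg, neg_sub]
    simpa using enorm_propagator_sub_le (ψ : FilterFn d) (u + v) u

/-- Dominated convergence with majorant `‖u * ψ‖²`. The minimum is essential: `∑ ‖v_m * ψ‖²` itself
need not tend to zero. -/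
theorem IsBessel.tendsto_tsum_min (hΦ : IsBessel Φ) (u : L2 d) {v : ℕ → L2 d}
    (hv : ∀ ψ : Φ, Filter.Tendsto (fun m => conv (v m) ψ) Filter.atTop (𝓝 0)) :
    Filter.Tendsto (fun m => ∑' ψ : Φ, min (‖conv u ψ‖ₑ ^ 2) (‖conv (v m) ψ‖ₑ ^ 2))
      Filter.atTop (𝓝 0) := by
  have hs : Summable fun ψ : Φ => ‖conv u ψ‖ ^ 2 := by
    have h := ENNReal.summable_toReal (f := fun ψ : Φ => ‖conv u ψ‖ₑ ^ 2)
      (ne_top_of_le_ne_top (by finiteness) (hΦ u))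
    simpa using h
  have hle : ∀ m (ψ : Φ), ‖min (‖conv u ψ‖ ^ 2) (‖conv (v m) ψ‖ ^ 2)‖ ≤ ‖conv u ψ‖ ^ 2 :=
    fun m ψ => by
      rw [Real.norm_of_nonneg (by positivity)]
      exact min_le_left _ _
  have h1 : Filter.Tendsto (fun m => ∑' ψ : Φ, min (‖conv u ψ‖ ^ 2) (‖conv (v m) ψ‖ ^ 2))
      Filter.atTop (𝓝 (∑' _ : Φ, (0 : ℝ))) := by
    refine tendsto_tsum_of_dominated_convergence hs (fun ψ => ?_)
      (Filter.Eventually.of_forall fun m ψ => hle m ψ)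
    have h2 := (tendsto_const_nhds (x := ‖conv u ψ‖ ^ 2)).min ((hv ψ).norm.pow 2)
    simpa using h2
  rw [tsum_zero] at h1
  have h3 := ENNReal.tendsto_ofReal h1
  rw [ENNReal.ofReal_zero] at h3
  refine h3.congr fun m => ?_
  rw [ENNReal.ofReal_tsum_of_nonneg (fun _ => by positivity)
    (Summable.of_norm_bounded hs (hle m))]
  refine tsum_congr fun ψ => ?_
  rw [ENNReal.ofReal_min, ENNReal.ofReal_pow (norm_nonneg _), ENNReal.ofReal_pow (norm_nonneg _),
    ofReal_norm, ofReal_norm]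

/-- Adding a bounded sequence whose convolution with every filter vanishes in the limit does not,
asymptotically, decrease the energy, uniformly over the path length. -/
theorem IsBessel.eventually_energyRemainder_le_add (hΦ : IsBessel Φ) (u : L2 d) {v : ℕ → L2 d}
    {R : ℝ} (hR : ∀ m, ‖v m‖ ≤ R)
    (hv : ∀ ψ : Φ, Filter.Tendsto (fun m => conv (v m) ψ) Filter.atTop (𝓝 0)) {ε : ℝ}
    (hε : 0 < ε) :
    ∀ᶠ m in Filter.atTop, ∀ N, 1 ≤ N →
      energyRemainder Φ N u ≤ energyRemainder Φ N (u + v m) + ENNReal.ofReal ε ∧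
      energyRemainder Φ N (v m) ≤ energyRemainder Φ N (u + v m) + ENNReal.ofReal ε := by
  set K : ℝ := (‖u‖ + R) ^ 2 + 1 with hK
  have hK0 : 0 < K := by positivity
  -- `K` bounds every `W_N(u + v_m)`, so the surplus factor `t` costs at most `t K = ε / 2`.
  set t : ℝ := ε / 2 / K with ht
  have ht0 : 0 < t := by positivity
  have hlim : Filter.Tendsto (fun m => ENNReal.ofReal (1 + t⁻¹) *
      ∑' ψ : Φ, min (‖conv u ψ‖ₑ ^ 2) (‖conv (v m) ψ‖ₑ ^ 2)) Filter.atTop (𝓝 0) := by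
    simpa using ENNReal.Tendsto.const_mul (hΦ.tendsto_tsum_min u hv)
      (Or.inr ENNReal.ofReal_ne_top)
  filter_upwards [hlim.eventually (ge_mem_nhds (ENNReal.ofReal_pos.2 (half_pos hε)))] with m hm N hN
  obtain ⟨n, rfl⟩ := Nat.exists_eq_add_of_le' hN
  have hw : ENNReal.ofReal (1 + t) * energyRemainder Φ (n + 1) (u + v m) ≤
      energyRemainder Φ (n + 1) (u + v m) + ENNReal.ofReal (ε / 2) := by
    rw [ENNReal.ofReal_add zero_le_one ht0.le, ENNReal.ofReal_one, add_mul, one_mul]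
    gcongr
    have h1 : energyRemainder Φ (n + 1) (u + v m) ≤ ENNReal.ofReal K := by
      refine (hΦ.energyRemainder_le _ _).trans ?_
      rw [← ofReal_norm, ← ENNReal.ofReal_pow (norm_nonneg _)]
      refine ENNReal.ofReal_le_ofReal ((pow_le_pow_left₀ (norm_nonneg _)
        ((norm_add_le _ _).trans (add_le_add_right (hR m) _)) 2).trans ?_)
      rw [hK]; linarith
    calc ENNReal.ofReal t * energyRemainder Φ (n + 1) (u + v m)
        ≤ ENNReal.ofReal t * ENNReal.ofReal K := by gcongr
      _ = ENNReal.ofReal (ε / 2) := by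
        rw [← ENNReal.ofReal_mul ht0.le, ht, div_mul_cancel₀ _ hK0.ne']
  have hε2 : ENNReal.ofReal ε = ENNReal.ofReal (ε / 2) + ENNReal.ofReal (ε / 2) := by
    rw [← ENNReal.ofReal_add (half_pos hε).le (half_pos hε).le, add_halves]
  rw [hε2, ← add_assoc]
  refine ⟨(hΦ.energyRemainder_succ_le_add n u (v m) ht0).trans (add_le_add hw hm), ?_⟩
  -- The minimum is symmetric in `u` and `v m`, so the same error term serves with the roles
  -- exchanged.
  have h2 := hΦ.energyRemainder_succ_le_add n (v m) u ht0
  simp only [min_comm (‖conv (v m) _‖ₑ ^ 2), add_comm (v m) u] at h2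
  exact h2.trans (add_le_add hw hm)

theorem IsBessel.energyRemainder_ne_top (hΦ : IsBessel Φ) (N : ℕ) (f : L2 d) :
    energyRemainder Φ N f ≠ ∞ :=
  ne_top_of_le_ne_top (by finiteness) (hΦ.energyRemainder_le N f)

theorem IsBessel.lipschitzWith_pathPropagator (hΦ : IsBessel Φ) {N : ℕ} (p : Fin N → Φ) :
    LipschitzWith 1 (pathPropagator N fun i => (p i : FilterFn d)) := by
  refine LipschitzWith.of_dist_le_mul fun f g => ?_
  have h := ENNReal.toReal_mono (by finiteness)
    ((ENNReal.le_tsum p).trans (hΦ.tsum_pathPropagator_sub_le N f g))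
  rw [ENNReal.toReal_pow, ENNReal.toReal_pow, toReal_enorm, toReal_enorm] at h
  simpa [dist_eq_norm] using le_of_sq_le_sq h (norm_nonneg _)

/-- Supplies the closed sublevel sets of the category argument. -/
theorem IsBessel.lowerSemicontinuous_energyRemainder (hΦ : IsBessel Φ) (N : ℕ) :
    LowerSemicontinuous (energyRemainder Φ N) :=
  lowerSemicontinuous_tsum fun p =>
    (((ENNReal.continuous_pow 2).comp continuous_enorm).comp
      (hΦ.lipschitzWith_pathPropagator p).continuous).lowerSemicontinuous

end Perturbation

/-! ### Signals with slow energy decay, and the category argument. -/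

section SlowDecay

variable {d : ℕ} {χ : FilterFn d} {Ψ : Set (FilterFn d)} {A : GL (Fin d) ℝ}

/-- The witness is `u + D²_{A^m} v` for large `m`. The limit is needed only at depth `M`, since the
energy is nonincreasing in `N`. -/
theorem IsFilterBank.exists_perturbation (h : IsFilterBank χ Ψ)
    (hA : 1 < |(A : Matrix (Fin d) (Fin d) ℝ).det|)
    (hincl : ∀ m : ℕ, 1 ≤ m → dilatedFilters A Ψ m ⊆ dilatedFilters A Ψ (m + 1))
    (u v : L2 d) {ε κ : ℝ} (hε : 0 < ε) (hκ : κ < ‖v‖ ^ 2) (M : ℕ) :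
    ∃ y : L2 d, ‖y - u‖ = ‖v‖ ∧
      (∀ N, 1 ≤ N → (energyRemainder Ψ N u).toReal ≤ (energyRemainder Ψ N y).toReal + ε) ∧
      ∀ N, 1 ≤ N → N ≤ M → κ ≤ (energyRemainder Ψ N y).toReal + ε := by
  have hB := h.isBessel
  have h1 := hB.eventually_energyRemainder_le_add u (v := fun m => dilation2 (A ^ m) v)
    (fun m => (norm_dilation2 _ _).le)
    (fun ψ => tendsto_conv_dilation2_zero hA (hB.norm_conv_le ψ) v) hε
  have h2 := (ENNReal.tendsto_toReal (by finiteness)).comp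
    (h.tendsto_energyRemainder hA hincl v M)
  rw [ENNReal.toReal_pow, toReal_enorm] at h2
  have hreal : ∀ {N : ℕ} {a b : L2 d},
      energyRemainder Ψ N a ≤ energyRemainder Ψ N b + ENNReal.ofReal ε →
      (energyRemainder Ψ N a).toReal ≤ (energyRemainder Ψ N b).toReal + ε := by
    intro N a b hab
    have h3 := ENNReal.toReal_mono
      (ENNReal.add_ne_top.2 ⟨hB.energyRemainder_ne_top N b, ENNReal.ofReal_ne_top⟩) hab
    rwa [ENNReal.toReal_add (hB.energyRemainder_ne_top N b) ENNReal.ofReal_ne_top,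
      ENNReal.toReal_ofReal hε.le] at h3
  obtain ⟨m, hm1, hm2⟩ := (h1.and (h2.eventually (lt_mem_nhds hκ))).exists
  refine ⟨u + dilation2 (A ^ m) v, ?_, fun N hN => hreal (hm1 N hN).1, fun N hN hNM => ?_⟩
  · rw [add_sub_cancel_left, norm_dilation2]
  · exact hm2.le.trans ((ENNReal.toReal_mono (hB.energyRemainder_ne_top _ _)
      (hB.energyRemainder_antitone _ hNM)).trans (hreal (hm1 N hN).2))

theorem IsFilterBank.exists_slow_decay (h : IsFilterBank χ Ψ)
    (hA : 1 < |(A : Matrix (Fin d) (Fin d) ℝ).det|)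
    (hincl : ∀ m : ℕ, 1 ≤ m → dilatedFilters A Ψ m ⊆ dilatedFilters A Ψ (m + 1))
    {g : L2 d} (hg : g ≠ 0) {E : ℕ → ℝ} (hE : IsNullSequence E) :
    ∃ f : L2 d, ‖f - g‖ ≤ 2 * (√(E 1) * ‖g‖) ∧
      ∀ N : ℕ, 1 ≤ N → ‖g‖ ^ 2 / 8 * E N ≤ (energyRemainder Ψ N f).toReal := by
  have hB := h.isBessel
  have hE1 : 0 < E 1 := hE.pos 1 le_rfl
  have hg0 : 0 < ‖g‖ := norm_pos_iff.2 hg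
  set G : ℝ := E 1 * ‖g‖ ^ 2 with hG
  have hG0 : 0 < G := by positivity
  -- Layers with `E N` above `4^{-(J+1)} E 1` lie before `M J`; the `J`-th perturbation has to serve
  -- those.
  have hM : ∀ J : ℕ, ∃ M : ℕ, ∀ N, M ≤ N → E N < (1 / 4) ^ (J + 1) * E 1 := fun J =>
    Filter.eventually_atTop.1 (hE.tendsto.eventually (gt_mem_nhds (by positivity)))
  choose M hM using hM
  set v : ℕ → L2 d := fun J => (((1 / 2) ^ J * √(E 1) : ℝ) : ℂ) • g with hv
  have hvn : ∀ J, ‖v J‖ = √(E 1) * ‖g‖ * (1 / 2) ^ J := fun J => by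
    rw [hv, norm_smul, Complex.norm_real, Real.norm_of_nonneg (by positivity)]
    ring
  have hvn2 : ∀ J, ‖v J‖ ^ 2 = (1 / 4) ^ J * G := fun J => by
    rw [hvn, mul_pow, mul_pow, Real.sq_sqrt hE1.le, ← pow_mul, mul_comm J 2, pow_mul, hG]
    norm_num [mul_comm]
  have hstep : ∀ (J : ℕ) (u : L2 d), ∃ y : L2 d, ‖y - u‖ = ‖v J‖ ∧
      (∀ N, 1 ≤ N → (energyRemainder Ψ N u).toReal ≤
        (energyRemainder Ψ N y).toReal + (1 / 4) ^ J * G / 8) ∧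
      ∀ N, 1 ≤ N → N ≤ M J →
        (1 / 4) ^ J * G / 2 ≤ (energyRemainder Ψ N y).toReal + (1 / 4) ^ J * G / 8 := by
    intro J u
    have hpos : 0 < (1 / 4 : ℝ) ^ J * G := by positivity
    exact h.exists_perturbation hA hincl u (v J) (by positivity)
      (by rw [hvn2]; linarith) (M J)
  choose next hn1 hn2 hn3 using hstep
  let f : ℕ → L2 d := fun J => Nat.rec g next J
  have hf : ∀ J, f (J + 1) = next J (f J) := fun J => rfl
  have hdist : ∀ J, dist (f J) (f (J + 1)) ≤ √(E 1) * ‖g‖ * (1 / 2) ^ J := fun J => by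
    rw [dist_comm, dist_eq_norm, hf, hn1, hvn]
  obtain ⟨F, hF⟩ := cauchySeq_tendsto_of_complete
    (cauchySeq_of_le_geometric _ _ (by norm_num) hdist)
  refine ⟨F, ?_, fun N hN => ?_⟩
  · have h1 := dist_le_of_le_geometric_of_tendsto₀ _ _ (by norm_num) hdist hF
    rw [dist_comm, dist_eq_norm] at h1
    refine h1.trans (le_of_eq ?_)
    ring
  have hEN := hE.pos N hN
  -- `i` is the scale with `4^{-(i+1)} E 1 < E N ≤ 4^{-i} E 1`; perturbation `i` supplies the energy
  -- at depth `N`.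
  obtain ⟨i, hi1, hi2⟩ := exists_nat_pow_near_of_lt_one (x := E N / E 1) (y := 1 / 4)
    (by positivity) ((div_le_one hE1).2 (hE.antitone (Set.mem_Ici.2 le_rfl) hN hN))
    (by norm_num) (by norm_num)
  rw [lt_div_iff₀ hE1] at hi1
  rw [div_le_iff₀ hE1] at hi2
  have hNM : N ≤ M i := by
    by_contra! hlt
    exact absurd (hM i N hlt.le) hi1.le.not_gt
  -- Stage `i` leaves `1/2 - 1/8 = 3/8` of `4^{-i} G`. The term with `/ 6` is the reserve for all
  -- later losses, since `∑_{l ≥ n} 4^{-l} / 8 = 4^{-n} / 6`.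
  have hlow : ∀ j, (1 / 4) ^ i * G / 3 + (1 / 4) ^ (i + 1 + j) * G / 6 ≤
      (energyRemainder Ψ N (f (i + 1 + j))).toReal := by
    intro j
    induction j with
    | zero =>
      have h1 := hn3 i (f i) N hN hNM
      rw [← hf] at h1
      rw [add_zero, pow_succ]
      linarith
    | succ j ih =>
      have h1 := hn2 (i + 1 + j) (f (i + 1 + j)) N hN
      rw [← hf] at h1
      rw [← add_assoc, pow_succ]
      linarith
  have hlim : Filter.Tendsto (fun j => 2 * (energyRemainder Ψ N F).toReal +
      2 * ‖f (i + 1 + j) - F‖ ^ 2) Filter.atTop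
      (𝓝 (2 * (energyRemainder Ψ N F).toReal)) := by
    have h1 : Filter.Tendsto (fun j => f (i + 1 + j)) Filter.atTop (𝓝 F) :=
      hF.comp (Filter.tendsto_atTop_mono (fun j => Nat.le_add_left j (i + 1)) Filter.tendsto_id)
    have h2 := ((tendsto_iff_norm_sub_tendsto_zero.1 h1).pow 2).const_mul 2
    simpa using h2.const_add (2 * (energyRemainder Ψ N F).toReal)
  -- Passing to the limit with `t = 1` costs a factor `2`, leaving `1/6`, which exceeds the required
  -- `1/8`.
  have hfin : (1 / 4) ^ i * G / 3 ≤ 2 * (energyRemainder Ψ N F).toReal := by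
    refine ge_of_tendsto' hlim fun j => ?_
    have h1 := hB.energyRemainder_le_add N (f (i + 1 + j)) F one_pos
    have h2 := hB.energyRemainder_ne_top N F
    have h3 := ENNReal.toReal_mono (by finiteness) h1
    rw [ENNReal.toReal_add (by finiteness) (by finiteness), ENNReal.toReal_mul,
      ENNReal.toReal_mul, ENNReal.toReal_pow, toReal_enorm,
      ENNReal.toReal_ofReal (by norm_num), ENNReal.toReal_ofReal (by norm_num)] at h3
    norm_num at h3
    have h4 : 0 ≤ (1 / 4 : ℝ) ^ (i + 1 + j) * G / 6 := by positivity
    linarith [hlow j]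
  have h5 : ‖g‖ ^ 2 * E N ≤ (1 / 4) ^ i * G := by
    rw [hG]
    calc ‖g‖ ^ 2 * E N ≤ ‖g‖ ^ 2 * ((1 / 4) ^ i * E 1) := by gcongr
      _ = _ := by ring
  have h6 : 0 ≤ ‖g‖ ^ 2 * E N := by positivity
  linarith

theorem IsNullSequence.mul_sqrt {E : ℕ → ℝ} (hE : IsNullSequence E) {s : ℝ} (hs : 0 < s) :
    IsNullSequence fun N => s * √(E N) where
  pos N hN := mul_pos hs (Real.sqrt_pos.2 (hE.pos N hN))
  antitone M hM N hN hMN :=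
    mul_le_mul_of_nonneg_left (Real.sqrt_le_sqrt (hE.antitone hM hN hMN)) hs.le
  tendsto := by simpa using (hE.tendsto.sqrt).const_mul s

/-- Provides unit vectors for `δ` and nonzero points in every nonempty open set. -/
instance {d : ℕ} : Nontrivial (L2 d) := by
  have hb : (volume : Measure (EuclideanSpace ℝ (Fin d))) (Metric.ball 0 1) ≠ ∞ :=
    measure_ball_lt_top.ne
  refine ⟨⟨indicatorConstLp 2 Metric.isOpen_ball.measurableSet hb 1, 0, fun h0 => ?_⟩⟩
  have h1 := norm_indicatorConstLp (p := 2) (hs := Metric.isOpen_ball.measurableSet) (hμs := hb)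
    (c := (1 : ℂ)) (by norm_num) (by norm_num)
  rw [h0, norm_zero, norm_one, one_mul] at h1
  have h2 : 0 < (volume : Measure (EuclideanSpace ℝ (Fin d))).real (Metric.ball 0 1) :=
    ENNReal.toReal_pos (Metric.measure_ball_pos _ _ one_pos).ne' hb
  exact (Real.rpow_pos_of_pos h2 _).ne h1

/-- Slow decay is applied to `s √E` instead of `E`: small `s` keeps the signal inside a given ball,
and `√E_N` eventually exceeds every multiple of `E_N`. -/
theorem IsFilterBank.isMeagre_fastDecay (h : IsFilterBank χ Ψ)
    (hA : 1 < |(A : Matrix (Fin d) (Fin d) ℝ).det|)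
    (hincl : ∀ m : ℕ, 1 ≤ m → dilatedFilters A Ψ m ⊆ dilatedFilters A Ψ (m + 1))
    {E : ℕ → ℝ} (hE : IsNullSequence E) : IsMeagre (fastDecay Ψ E) := by
  have hB := h.isBessel
  -- One index `n` governs both the constant and the threshold, which makes the union countable.
  let F : ℕ → Set (L2 d) := fun n => ⋂ N ∈ Set.Ici (n + 1),
    energyRemainder Ψ N ⁻¹' Set.Iic (ENNReal.ofReal ((n + 1 : ℝ) * E N))
  have hsub : fastDecay Ψ E ⊆ ⋃ n, F n := by
    rintro f ⟨C, hC, N₀, hN₀, hf⟩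
    obtain ⟨n, hn⟩ := exists_nat_ge (max C N₀)
    have hn1 : N₀ ≤ n := by exact_mod_cast (le_max_right _ _).trans hn
    refine Set.mem_iUnion.2 ⟨n, Set.mem_iInter₂.2 fun N hN => ?_⟩
    have hN' : n + 1 ≤ N := hN
    refine (hf N (by omega)).trans (ENNReal.ofReal_le_ofReal ?_)
    exact mul_le_mul_of_nonneg_right (by linarith [(le_max_left C (N₀ : ℝ)).trans hn])
      (hE.pos N (by omega)).le
  refine IsMeagre.mono hsub (isMeagre_iUnion fun n => IsNowhereDense.isMeagre ?_)
  have hcl : IsClosed (F n) := isClosed_biInter fun N _ =>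
    (hB.lowerSemicontinuous_energyRemainder N).isClosed_preimage _
  rw [hcl.isNowhereDense_iff, Set.eq_empty_iff_forall_notMem]
  intro f₀ hf₀
  -- The centre must be nonzero, as the lower bound scales with `‖g‖²`.
  obtain ⟨g, hgF, hg⟩ : ∃ g ∈ interior (F n), g ≠ 0 :=
    (dense_compl_singleton (0 : L2 d)).inter_open_nonempty _ isOpen_interior ⟨f₀, hf₀⟩
  obtain ⟨r, hr, hball⟩ := Metric.isOpen_iff.1 isOpen_interior g hgF
  have hg0 : 0 < ‖g‖ := norm_pos_iff.2 hg
  obtain ⟨s, hs, hsr⟩ : ∃ s : ℝ, 0 < s ∧ 2 * (√(s * √(E 1)) * ‖g‖) < r := by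
    have hc : Continuous fun s : ℝ => 2 * (√(s * √(E 1)) * ‖g‖) := by fun_prop
    have h0 : 2 * (√((0 : ℝ) * √(E 1)) * ‖g‖) < r := by simpa using hr
    obtain ⟨s, hs, hs'⟩ := (((hc.tendsto 0).eventually (gt_mem_nhds h0)).filter_mono
      nhdsWithin_le_nhds |>.and (self_mem_nhdsWithin (s := Set.Ioi (0 : ℝ)))).exists
    exact ⟨s, hs', hs⟩
  obtain ⟨f, hfg, hf⟩ := h.exists_slow_decay hA hincl hg (hE.mul_sqrt hs)
  have hfF : f ∈ F n := interior_subset (hball (by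
    rw [Metric.mem_ball, dist_eq_norm]; exact hfg.trans_lt hsr))
  have hc0 : 0 < ‖g‖ ^ 2 / 8 * s := by positivity
  have hlb : ∀ N, n + 1 ≤ N → ‖g‖ ^ 2 / 8 * s ≤ (n + 1) * √(E N) := by
    intro N hN
    have hEN := hE.pos N (by omega)
    have h1 : energyRemainder Ψ N f ≤ ENNReal.ofReal ((n + 1 : ℝ) * E N) :=
      Set.mem_iInter₂.1 hfF N hN
    have h2 := (hf N (by omega)).trans (ENNReal.toReal_le_of_le_ofReal (by positivity) h1)
    refine le_of_mul_le_mul_right ?_ (Real.sqrt_pos.2 hEN)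
    calc ‖g‖ ^ 2 / 8 * s * √(E N) = ‖g‖ ^ 2 / 8 * (s * √(E N)) := by ring
      _ ≤ (n + 1) * E N := h2
      _ = (n + 1) * √(E N) * √(E N) := by rw [mul_assoc, Real.mul_self_sqrt hEN.le]
  have hlim : Filter.Tendsto (fun N => ((n : ℝ) + 1) * √(E N)) Filter.atTop (𝓝 0) := by
    simpa using hE.tendsto.sqrt.const_mul ((n : ℝ) + 1)
  exact absurd (ge_of_tendsto hlim (Filter.eventually_atTop.2 ⟨n + 1, hlb⟩)) hc0.not_ge

theorem deltaConst_eq_one {B : ℕ → GL (Fin d) ℝ}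
    (hB : ∀ (f : L2 d) (k : ℕ), 1 ≤ k → Filter.Tendsto
      (fun m : ℕ => energyRemainder Ψ k (dilation2 (B m) f)) Filter.atTop (𝓝 (‖f‖ₑ ^ 2))) :
    deltaConst Ψ B = 1 := by
  have hval : ∀ f : L2 d, ‖f‖ = 1 → ∀ k, 1 ≤ k → Filter.limsup
      (fun m => energyRemainder Ψ k (dilation2 (B m) f)) Filter.atTop = 1 := by
    intro f hf k hk
    rw [(hB f k hk).limsup_eq, ← ofReal_norm, hf]
    simp
  refine le_antisymm ?_ (le_iInf₂ fun f hf => le_iInf₂ fun k hk => (hval f hf k hk).ge)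
  -- Without a unit vector the infimum would be `∞`.
  obtain ⟨f, hf⟩ := exists_norm_eq (L2 d) zero_le_one
  exact (iInf₂_le f hf).trans ((iInf₂_le 1 le_rfl).trans (hval f hf 1 le_rfl).le)

end SlowDecay

end Scattering

theorem mainTheorem11 (d : ℕ) (hd : 1 ≤ d)
    (χ : Scattering.FilterFn d) (Ψ : Set (Scattering.FilterFn d))
    (hΨ : Scattering.IsFilterBank χ Ψ)
    (A : Matrix.GeneralLinearGroup (Fin d) ℝ)
    (hA : 1 < Scattering.sigmaMin (A : Matrix (Fin d) (Fin d) ℝ))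
    (hincl : ∀ m : ℕ, 1 ≤ m →
      Scattering.dilatedFilters A Ψ m ⊆ Scattering.dilatedFilters A Ψ (m + 1)) :
    Scattering.IsSemiDiscreteParsevalFrame
      (fun ψ : Scattering.unionDilatedFilters A Ψ => (ψ : Scattering.FilterFn d)) ∧
    (∀ (f : Scattering.L2 d) (k : ℕ), 1 ≤ k →
      Filter.Tendsto (fun m : ℕ =>
          Scattering.energyRemainder Ψ k (Scattering.dilation2 (A ^ m) f))
        Filter.atTop (𝓝 (‖f‖ₑ ^ 2))) ∧
    Scattering.deltaConst Ψ (fun m => A ^ m) = 1 ∧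
    (∀ g : Scattering.L2 d, ∃ C : ℝ, 0 < C ∧
      ∀ E : ℕ → ℝ, Scattering.IsNullSequence E →
        ∃ f : Scattering.L2 d,
          ‖f‖ ^ 2 ≤ C * (1 + E 1) ∧
          ‖f - g‖ ^ 2 ≤ C * E 1 ∧
          ∀ N : ℕ, 1 ≤ N →
            ENNReal.ofReal (‖g‖ ^ 2 / 8 * E N) ≤ Scattering.energyRemainder Ψ N f) ∧
    (∀ E : ℕ → ℝ, Scattering.IsNullSequence E →
      IsMeagre (Scattering.fastDecay Ψ E) ∧ Dense (Scattering.fastDecay Ψ E)ᶜ) := by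
  have hdet := Scattering.one_lt_abs_det hd hA
  have hlim : ∀ (f : Scattering.L2 d) (k : ℕ), 1 ≤ k →
      Filter.Tendsto (fun m : ℕ =>
          Scattering.energyRemainder Ψ k (Scattering.dilation2 (A ^ m) f))
        Filter.atTop (𝓝 (‖f‖ₑ ^ 2)) := fun f k _ =>
    hΨ.tendsto_energyRemainder hdet hincl f k
  refine ⟨hΨ.isSemiDiscreteParsevalFrame_union hdet hincl, hlim,
    Scattering.deltaConst_eq_one hlim, fun g => ?_, fun E hE => ?_⟩
  · rcases eq_or_ne g 0 with rfl | hg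
    · refine ⟨1, one_pos, fun E hE => ⟨0, ?_, ?_, ?_⟩⟩
      · simpa using (add_pos one_pos (hE.pos 1 le_rfl)).le
      · simpa using (hE.pos 1 le_rfl).le
      · simp
    have hg0 : 0 < ‖g‖ := norm_pos_iff.2 hg
    -- From `‖f - g‖² ≤ 4 ‖g‖² E_1` one gets `‖f‖² ≤ 8 ‖g‖² E_1 + 2 ‖g‖²`. This constant is positive
    -- only for `g ≠ 0`; for `g = 0` the signal `f = 0` works.
    refine ⟨8 * ‖g‖ ^ 2, by positivity, fun E hE => ?_⟩
    obtain ⟨f, hf1, hf2⟩ := hΨ.exists_slow_decay hdet hincl hg hE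
    have hE1 := hE.pos 1 le_rfl
    have h1 : ‖f - g‖ ^ 2 ≤ 4 * (‖g‖ ^ 2 * E 1) := by
      refine (pow_le_pow_left₀ (norm_nonneg _) hf1 2).trans (le_of_eq ?_)
      rw [mul_pow, mul_pow, Real.sq_sqrt hE1.le]
      ring
    have h2 : ‖f‖ ^ 2 ≤ 2 * (‖f - g‖ ^ 2 + ‖g‖ ^ 2) := by
      have h3 : ‖f‖ ≤ ‖f - g‖ + ‖g‖ := by simpa using norm_add_le (f - g) g
      exact (pow_le_pow_left₀ (norm_nonneg _) h3 2).trans add_sq_le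
    have h4 : 0 ≤ ‖g‖ ^ 2 * E 1 := by positivity
    refine ⟨f, by nlinarith [sq_nonneg ‖g‖], by nlinarith, fun N hN => ?_⟩
    exact ENNReal.ofReal_le_of_le_toReal (hf2 N hN)
  · have hm := hΨ.isMeagre_fastDecay hdet hincl hE
    exact ⟨hm, dense_of_mem_residual hm⟩
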